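/- Let $k$ be an algebraically closed field of characteristic $0$, let $G$ be a finite abelian group with character group $G^*=\mathrm{Hom}(G,k^*)$, and let $F:G\times G\to k^*$ be a non-degenerate skew symmetric bilinear form: $F$ is multiplicative in each variable, $F(x,y)=F(y,x)^{-1}$, and $f:G\to G^*$, $\langle f(x),y\rangle=F(x,y)$, is an isomorphism. Put $I_F=\{g\in G: F(g,g)=-1\}$, let $n:I_F\to\mathbb Z_{\ge 0}$, $g\mapsto n_g$, be a function, ${\cal D}=(G,F,n)$, and $I_F'=\{g\in I_F:n_g\neq 0\}$. For $g\in I_F$ let $V_g$ be a $k$-vector space of dimension $n_g$. Let $H({\cal D})$ be the Hopf algebra generated as an algebra by $G$ and the spaces $V_g$ $(g\in I_F)$, subject to the relations of the group $G$ and of the vector spaces $V_g$ and $$xy=F(h,g)\,yx,\qquad xa=F(a,g)\,ax\qquad (g,h\in I_F,\ x\in V_g,\ y\in V_h,\ a\in G),$$ with $\Delta(a)=a\otimes a$, $\varepsilon(a)=1$ for $a\in G$ and $\Delta(x)=x\otimes 1+g\otimes x$, $\varepsilon(x)=0$ for $x\in V_g$. It is finite-dimensional; $H({\cal D})^{*cop}$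 denotes its dual Hopf algebra with opposite coproduct. Extend $\alpha\in G^*$ to an algebra homomorphism $H({\cal D})\to k$ by $0$ on all $V_g$. For $x\in V_g^*$ let $P_x\in H({\cal D})^*$ be the functional with $\langle P_x,ay\rangle=\delta_{g,h}\langle x,y\rangle$ for $a\in G$, $y\in V_h$, and $\langle P_x,ay\rangle=0$ for $a\in G$ and $y$ a product of $m\ne 1$ elements of the spaces $V_h$. Let $\Phi$ be the set of isomorphisms $\varphi:G^*\to G$ with $\varphi^*(\alpha)=\varphi(\alpha^{-1})$ for all $\alpha\in G^*$ (that is, $\langle\alpha,\varphi(\beta)\rangle=\langle\beta,\varphi(\alpha^{-1})\rangle$ for all $\alpha,\beta\in G^*$) and $\varphi(f(g))=g$ for all $g\in I_F'$. Let $S(k)$ be the set of families $(M_g)_{g\in I_F'}$ of linear isomorphisms $M_g:V_g^*\to V_{g^{-1}}$ with $M_g^*=M_{g^{-1}}$ for all $g\in I_F'$. A triangular structure on a Hopf algebra $A$ is an element $R\in A\otimes A$ with $(\Delta\otimes I)(R)=R_{13}R_{23}$, $(I\otimes\Delta)(R)=R_{13}R_{12}$, $\Delta^{cop}(a)R=R\Delta(a)$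 for all $a\in A$, and $R^{-1}=R_{21}$; it is minimal if no proper sub Hopf algebra $B$ of $A$ satisfies $R\in B\otimes B$. Write $f_R:A^{*cop}\to A$, $f_R(p)=(p\otimes I)(R)$. Theorem 4.4. 1) For each $T=(\varphi,(M_g))\in\Phi\times S(k)$ there is a unique Hopf algebra isomorphism $f_T:H({\cal D})^{*cop}\to H({\cal D})$ with $f_T(\alpha)=\varphi(\alpha)$ for all $\alpha\in G^*$ and $f_T(P_x)=M_g(x)$ for all $g\in I_F'$ and $x\in V_g^*$. 2) For each $T\in\Phi\times S(k)$ there is a minimal triangular structure $R_T$ on $H({\cal D})$ with $f_{R_T}=f_T$, and $T\mapsto R_T$ is a bijection from $\Phi\times S(k)$ onto the set of minimal triangular structures on $H({\cal D})$. -/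

import Mathlib

open scoped TensorProduct

noncomputable section

namespace TriHopf

universe u v w

/-! ### The co-opposite dual of a finite-dimensional bialgebra -/

section DualCop

variable (k : Type u) [Field k] (A : Type v) [Ring A] [Bialgebra k A]

/-- The co-opposite dual `A^{*cop}` of a bialgebra `A`: as a vector space the linear dual of `A`,
with the convolution product `(p q)(a) = ∑ p(a₁) q(a₂)`, and, when `A` is finite-dimensional,
with the opposite of the coproduct that is dual to the product of `A`. -/
def DualCop : Type (max u v) := WithConv (A →ₗ[k] k)

instance : Ring (DualCop k A) := inferInstanceAs (Ring (WithConv (A →ₗ[k] k)))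

instance : Algebra k (DualCop k A) := inferInstanceAs (Algebra k (WithConv (A →ₗ[k] k)))

/-- `A^{*cop}` is the linear dual of `A` as a vector space. -/
def DualCop.toDual : DualCop k A ≃ₗ[k] Module.Dual k A := WithConv.linearEquiv k (A →ₗ[k] k)

variable {k A}

/-- A linear functional on `A`, seen as an element of `A^{*cop}`. -/
def DualCop.of (p : Module.Dual k A) : DualCop k A := (DualCop.toDual k A).symm p

/-- Evaluation at `a ∈ A`. -/
def DualCop.ev (a : A) : DualCop k A →ₗ[k] k :=
  Module.Dual.eval k A a ∘ₗ (DualCop.toDual k A).toLinearMap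

/-- Evaluation of a tensor in `A^{*cop} ⊗ A^{*cop}` at `a ⊗ b`. -/
def DualCop.ev₂ (a b : A) : DualCop k A ⊗[k] DualCop k A →ₗ[k] k :=
  LinearMap.mul' k k ∘ₗ TensorProduct.map (DualCop.ev a) (DualCop.ev b)

@[simp] theorem DualCop.ev_of (a : A) (p : Module.Dual k A) :
    DualCop.ev a (DualCop.of p) = p a := rfl

@[simp] theorem DualCop.ev₂_tmul (a b : A) (p q : DualCop k A) :
    DualCop.ev₂ a b (p ⊗ₜ[k] q) = DualCop.ev a p * DualCop.ev b q := rfl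

theorem DualCop.ev_one (a : A) :
    DualCop.ev a (1 : DualCop k A) = Coalgebra.counit (R := k) a := rfl

theorem DualCop.ev_mul (a : A) (p q : DualCop k A) {ι : Type*} (r : Coalgebra.Repr k a ι) :
    DualCop.ev a (p * q) =
      ∑ i ∈ r.index, DualCop.ev (r.left i) p * DualCop.ev (r.right i) q :=
  r.convMul_apply (A := k) p q

theorem DualCop.ext_ev {p q : DualCop k A} (h : ∀ a : A, DualCop.ev a p = DualCop.ev a q) :
    p = q :=
  (DualCop.toDual k A).injective (LinearMap.ext h)

theorem DualCop.ev_linear_mul (b : A) (p : DualCop k A) :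
    DualCop.ev b p = DualCop.toDual k A p b := rfl

theorem DualCop.ev₂_mul (a b : A) (s t : DualCop k A ⊗[k] DualCop k A) {ι κ : Type*}
    (r : Coalgebra.Repr k a ι) (r' : Coalgebra.Repr k b κ) :
    DualCop.ev₂ a b (s * t) = ∑ i ∈ r.index, ∑ j ∈ r'.index,
      DualCop.ev₂ (r.left i) (r'.left j) s * DualCop.ev₂ (r.right i) (r'.right j) t := by
  induction s with
  | zero => simp
  | add x y hx hy => simp [add_mul, hx, hy, Finset.sum_add_distrib]
  | tmul p q =>
    induction t with
    | zero => simp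
    | add x y hx hy => simp [mul_add, hx, hy, Finset.sum_add_distrib]
    | tmul p' q' =>
      simp only [Algebra.TensorProduct.tmul_mul_tmul, DualCop.ev₂_tmul, DualCop.ev_mul a p p' r,
        DualCop.ev_mul b q q' r', Finset.sum_mul_sum]
      refine Finset.sum_congr rfl fun i _ => Finset.sum_congr rfl fun j _ => ?_
      ring

theorem DualCop.ev_mul_mul (a b : A) (p q : DualCop k A) {ι κ : Type*}
    (r : Coalgebra.Repr k a ι) (r' : Coalgebra.Repr k b κ) :
    DualCop.ev (a * b) (p * q) = ∑ i ∈ r.index, ∑ j ∈ r'.index,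
      DualCop.ev (r.left i * r'.left j) p * DualCop.ev (r.right i * r'.right j) q := by
  have h : DualCop.ev (a * b) (p * q) = LinearMap.mul' k k
      (TensorProduct.map (DualCop.toDual k A p) (DualCop.toDual k A q)
        (Coalgebra.comul (R := k) (a * b))) := rfl
  rw [h, Bialgebra.comul_mul, ← r.eq, ← r'.eq, Finset.sum_mul_sum]
  simp [DualCop.ev_linear_mul]

variable [Module.Finite k A]

variable (k A) in
/-- For finite-dimensional `A`: `A^{*cop} ⊗ A^{*cop}` is the linear dual of `A ⊗ A`. -/
def DualCop.tensorEquiv : DualCop k A ⊗[k] DualCop k A ≃ₗ[k] Module.Dual k (A ⊗[k] A) :=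
  (TensorProduct.congr (DualCop.toDual k A) (DualCop.toDual k A)).trans
    (TensorProduct.dualDistribEquiv k A A)

theorem DualCop.tensorEquiv_apply (t : DualCop k A ⊗[k] DualCop k A) (a b : A) :
    DualCop.tensorEquiv k A t (a ⊗ₜ b) = DualCop.ev₂ a b t := by
  induction t with
  | zero => simp
  | add x y hx hy => simp [hx, hy]
  | tmul p q => rfl

theorem DualCop.ext_ev₂ {s t : DualCop k A ⊗[k] DualCop k A}
    (h : ∀ a b : A, DualCop.ev₂ a b s = DualCop.ev₂ a b t) : s = t := by
  apply (DualCop.tensorEquiv k A).injective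
  ext a b
  simpa [DualCop.tensorEquiv_apply] using h a b

/-- The coproduct of `A^{*cop}`, characterized by `Δ(p)(a ⊗ b) = p(b a)`. -/
instance : CoalgebraStruct k (DualCop k A) where
  comul := (DualCop.tensorEquiv k A).symm.toLinearMap ∘ₗ
    Module.Dual.transpose
      (LinearMap.mul' k A ∘ₗ (TensorProduct.comm k A A).toLinearMap) ∘ₗ
    (DualCop.toDual k A).toLinearMap
  counit := DualCop.ev 1

theorem DualCop.counit_apply (p : DualCop k A) :
    Coalgebra.counit (R := k) p = DualCop.ev 1 p := rfl

theorem DualCop.ev₂_comul (a b : A) (p : DualCop k A) :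
    DualCop.ev₂ a b (Coalgebra.comul (R := k) p) = DualCop.ev (b * a) p := by
  rw [← DualCop.tensorEquiv_apply]
  simp [CoalgebraStruct.comul, Module.Dual.transpose_apply]
  rfl

/-- Evaluation of a triple tensor. -/
def DualCop.ev₃ (a b c : A) : DualCop k A ⊗[k] (DualCop k A ⊗[k] DualCop k A) →ₗ[k] k :=
  LinearMap.mul' k k ∘ₗ TensorProduct.map (DualCop.ev a) (DualCop.ev₂ b c)

theorem DualCop.ext_ev₃ {s t : DualCop k A ⊗[k] (DualCop k A ⊗[k] DualCop k A)}
    (h : ∀ a b c : A, DualCop.ev₃ a b c s = DualCop.ev₃ a b c t) : s = t := by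
  let E := (TensorProduct.congr (DualCop.toDual k A) (DualCop.tensorEquiv k A)).trans
    (TensorProduct.dualDistribEquiv k A (A ⊗[k] A))
  have hE : ∀ (t : DualCop k A ⊗[k] (DualCop k A ⊗[k] DualCop k A)) (a b c : A),
      E t (a ⊗ₜ (b ⊗ₜ c)) = DualCop.ev₃ a b c t := by
    intro t a b c
    induction t with
    | zero => simp
    | add x y hx hy => simp [hx, hy]
    | tmul p q =>
      have : E (p ⊗ₜ q) (a ⊗ₜ (b ⊗ₜ c)) =
        DualCop.toDual k A p a * DualCop.tensorEquiv k A q (b ⊗ₜ c) := rfl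
      rw [this, DualCop.tensorEquiv_apply]; rfl
  apply E.injective
  ext a b c
  simpa [hE] using h a b c

instance : Coalgebra k (DualCop k A) where
  coassoc := by
    apply LinearMap.ext; intro p
    apply DualCop.ext_ev₃; intro a b c
    have h1 : DualCop.ev₃ a b c ∘ₗ (TensorProduct.assoc k (DualCop k A) (DualCop k A)
        (DualCop k A)).toLinearMap ∘ₗ
        (Coalgebra.comul (R := k) (A := DualCop k A)).rTensor (DualCop k A) =
        DualCop.ev₂ (b * a) c := by
      have h0 : DualCop.ev₃ a b c ∘ₗ (TensorProduct.assoc k (DualCop k A) (DualCop k A)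
          (DualCop k A)).toLinearMap =
          LinearMap.mul' k k ∘ₗ TensorProduct.map (DualCop.ev₂ a b) (DualCop.ev c) := by
        apply TensorProduct.ext_threefold; intro x y z
        simp [DualCop.ev₃, mul_assoc]
      rw [← LinearMap.comp_assoc, h0]
      apply TensorProduct.ext'; intro x y
      simp [DualCop.ev₂_comul]
    have h2 : DualCop.ev₃ a b c ∘ₗ
        (Coalgebra.comul (R := k) (A := DualCop k A)).lTensor (DualCop k A) =
        DualCop.ev₂ a (c * b) := by
      apply TensorProduct.ext'; intro x y
      simp [DualCop.ev₃, DualCop.ev₂_comul]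
    have h1' := LinearMap.congr_fun h1 (Coalgebra.comul (R := k) p)
    have h2' := LinearMap.congr_fun h2 (Coalgebra.comul (R := k) p)
    rw [DualCop.ev₂_comul] at h1' h2'
    simp only [LinearMap.comp_apply] at h1' h2' ⊢
    rw [h1', h2', mul_assoc]
  rTensor_counit_comp_comul := by
    apply LinearMap.ext; intro p
    apply (TensorProduct.lid k (DualCop k A)).injective
    apply DualCop.ext_ev; intro b
    have h1 : DualCop.ev b ∘ₗ (TensorProduct.lid k (DualCop k A)).toLinearMap ∘ₗ
        (Coalgebra.counit (R := k) (A := DualCop k A)).rTensor (DualCop k A) =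
        DualCop.ev₂ 1 b := by
      apply TensorProduct.ext'; intro x y
      simp [DualCop.counit_apply]
    have h2 := LinearMap.congr_fun h1 (Coalgebra.comul (R := k) p)
    rw [DualCop.ev₂_comul] at h2
    simpa using h2
  lTensor_counit_comp_comul := by
    apply LinearMap.ext; intro p
    apply (TensorProduct.rid k (DualCop k A)).injective
    apply DualCop.ext_ev; intro b
    have h1 : DualCop.ev b ∘ₗ (TensorProduct.rid k (DualCop k A)).toLinearMap ∘ₗ
        (Coalgebra.counit (R := k) (A := DualCop k A)).lTensor (DualCop k A) =
        DualCop.ev₂ b 1 := by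
      apply TensorProduct.ext'; intro x y
      simp [DualCop.counit_apply, mul_comm]
    have h2 := LinearMap.congr_fun h1 (Coalgebra.comul (R := k) p)
    rw [DualCop.ev₂_comul] at h2
    simpa using h2

instance : Bialgebra k (DualCop k A) :=
  Bialgebra.mk' k (DualCop k A)
    (by simp [DualCop.counit_apply, DualCop.ev_one])
    (by
      intro p q
      simp only [DualCop.counit_apply]
      have h : DualCop.ev (1 : A) (p * q) = LinearMap.mul' k k
        (TensorProduct.map (DualCop.toDual k A p) (DualCop.toDual k A q)
          (Coalgebra.comul (R := k) (1 : A))) := rfl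
      rw [h, Bialgebra.comul_one]; rfl)
    (by
      apply DualCop.ext_ev₂; intro a b
      rw [DualCop.ev₂_comul, DualCop.ev_one, Bialgebra.counit_mul, Algebra.TensorProduct.one_def,
        DualCop.ev₂_tmul, DualCop.ev_one, DualCop.ev_one, mul_comm])
    (by
      intro p q
      apply DualCop.ext_ev₂; intro a b
      rw [DualCop.ev₂_comul, DualCop.ev₂_mul a b _ _ (Coalgebra.Repr.arbitrary k a)
        (Coalgebra.Repr.arbitrary k b), DualCop.ev_mul_mul b a _ _ (Coalgebra.Repr.arbitrary k b)
        (Coalgebra.Repr.arbitrary k a), Finset.sum_comm]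
      simp only [DualCop.ev₂_comul])

/-- If `T` is a skew antipode of `A`, i.e. `∑ a₂ T(a₁) = ε(a) 1 = ∑ T(a₂) a₁` (equivalently, when
`A` has an antipode, `T` is its inverse), then `A^{*cop}` is a Hopf algebra with antipode
`p ↦ p ∘ T`. -/
abbrev DualCop.hopfOfSkewAntipode (T : A →ₗ[k] A)
    (h₁ : LinearMap.mul' k A ∘ₗ T.lTensor A ∘ₗ (TensorProduct.comm k A A).toLinearMap ∘ₗ
      Coalgebra.comul = Algebra.linearMap k A ∘ₗ Coalgebra.counit)
    (h₂ : LinearMap.mul' k A ∘ₗ T.rTensor A ∘ₗ (TensorProduct.comm k A A).toLinearMap ∘ₗ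
      Coalgebra.comul = Algebra.linearMap k A ∘ₗ Coalgebra.counit) :
    HopfAlgebra k (DualCop k A) where
  antipode := (DualCop.toDual k A).symm.toLinearMap ∘ₗ Module.Dual.transpose T ∘ₗ
    (DualCop.toDual k A).toLinearMap
  mul_antipode_rTensor_comul := by
    apply LinearMap.ext; intro p
    apply DualCop.ext_ev; intro c
    let r := Coalgebra.Repr.arbitrary k c
    have key : ∀ t : DualCop k A ⊗[k] DualCop k A,
        DualCop.ev c (LinearMap.mul' k _ (((DualCop.toDual k A).symm.toLinearMap ∘ₗ
          Module.Dual.transpose T ∘ₗ (DualCop.toDual k A).toLinearMap).rTensor _ t)) =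
        ∑ i ∈ r.index, DualCop.ev₂ (T (r.left i)) (r.right i) t := by
      intro t
      induction t with
      | zero => simp
      | add x y hx hy => simp only [map_add, hx, hy, Finset.sum_add_distrib]
      | tmul p q =>
        simp only [LinearMap.rTensor_tmul, LinearMap.mul'_apply, DualCop.ev_mul c _ _ r]
        rfl
    have h := LinearMap.congr_fun h₁ c
    simp only [LinearMap.comp_apply, ← r.eq] at h
    simp only [LinearMap.comp_apply, key, DualCop.ev₂_comul]
    simp only [map_sum, LinearEquiv.coe_coe, TensorProduct.comm_tmul, LinearMap.lTensor_tmul,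
      LinearMap.mul'_apply, Algebra.linearMap_apply] at h
    simp only [DualCop.ev_linear_mul, ← map_sum, h]
    rw [Algebra.algebraMap_eq_smul_one, map_smul, Algebra.linearMap_apply,
      Algebra.algebraMap_eq_smul_one, map_smul, LinearMap.smul_apply, smul_eq_mul, smul_eq_mul,
      mul_comm]
    rfl
  mul_antipode_lTensor_comul := by
    apply LinearMap.ext; intro p
    apply DualCop.ext_ev; intro c
    let r := Coalgebra.Repr.arbitrary k c
    have key : ∀ t : DualCop k A ⊗[k] DualCop k A,
        DualCop.ev c (LinearMap.mul' k _ (((DualCop.toDual k A).symm.toLinearMap ∘ₗ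
          Module.Dual.transpose T ∘ₗ (DualCop.toDual k A).toLinearMap).lTensor _ t)) =
        ∑ i ∈ r.index, DualCop.ev₂ (r.left i) (T (r.right i)) t := by
      intro t
      induction t with
      | zero => simp
      | add x y hx hy => simp only [map_add, hx, hy, Finset.sum_add_distrib]
      | tmul p q =>
        simp only [LinearMap.lTensor_tmul, LinearMap.mul'_apply, DualCop.ev_mul c _ _ r]
        rfl
    have h := LinearMap.congr_fun h₂ c
    simp only [LinearMap.comp_apply, ← r.eq] at h
    simp only [LinearMap.comp_apply, key, DualCop.ev₂_comul]
    simp only [map_sum, LinearEquiv.coe_coe, TensorProduct.comm_tmul, LinearMap.rTensor_tmul,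
      LinearMap.mul'_apply, Algebra.linearMap_apply] at h
    simp only [DualCop.ev_linear_mul, ← map_sum, h]
    rw [Algebra.algebraMap_eq_smul_one, map_smul, Algebra.linearMap_apply,
      Algebra.algebraMap_eq_smul_one, map_smul, LinearMap.smul_apply, smul_eq_mul, smul_eq_mul,
      mul_comm]
    rfl

end DualCop

/-! ### Minimal triangular structures -/

section Triangular

variable (k : Type u) [Field k] {A : Type v} [Ring A]

section

variable [Bialgebra k A]

/-- `R = ∑ aᵢ ⊗ bᵢ` is a triangular structure (a triangular `R`-matrix) on `A`. -/
structure IsTriangular (R : A ⊗[k] A) : Prop where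
  /-- `(Δ ⊗ I)(R) = R₁₃ R₂₃` -/
  comul_left : TensorProduct.assoc k A A A ((Coalgebra.comul (R := k) (A := A)).rTensor A R) =
    TensorProduct.leftComm k A A A (1 ⊗ₜ[k] R) * (1 ⊗ₜ[k] R)
  /-- `(I ⊗ Δ)(R) = R₁₃ R₁₂` -/
  comul_right : (Coalgebra.comul (R := k) (A := A)).lTensor A R =
    TensorProduct.leftComm k A A A (1 ⊗ₜ[k] R) * TensorProduct.assoc k A A A (R ⊗ₜ[k] 1)
  /-- `Δ^{cop}(a) R = R Δ(a)` for all `a` -/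
  comul_comm : ∀ a : A, TensorProduct.comm k A A (Coalgebra.comul (R := k) a) * R =
    R * Coalgebra.comul (R := k) a
  /-- `R⁻¹ = R₂₁` -/
  mul_swap : R * TensorProduct.comm k A A R = 1
  /-- `R⁻¹ = R₂₁` -/
  swap_mul : TensorProduct.comm k A A R * R = 1

/-- The map `f_R : A^{*cop} → A`, `f_R(p) = (p ⊗ I)(R)`. -/
def fR (R : A ⊗[k] A) (p : DualCop k A) : A :=
  TensorProduct.lid k A ((DualCop.toDual k A p).rTensor A R)

end

variable [HopfAlgebra k A]

/-- The subalgebra `B` is a sub Hopf algebra of `A`: `Δ(B) ⊆ B ⊗ B` and `S(B) ⊆ B`. -/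
structure IsSubHopf (B : Subalgebra k A) : Prop where
  comul_mem : ∀ b ∈ B, Coalgebra.comul (R := k) b ∈
    LinearMap.range (TensorProduct.map B.val.toLinearMap B.val.toLinearMap)
  antipode_mem : ∀ b ∈ B, HopfAlgebra.antipode k b ∈ B

/-- `R` is a minimal triangular structure on `A`: it is triangular, and the only sub Hopf algebra
`B` of `A` with `R ∈ B ⊗ B` is `A` itself. -/
structure IsMinimalTriangular (R : A ⊗[k] A) : Prop extends IsTriangular k R where
  minimal : ∀ B : Subalgebra k A, IsSubHopf k B →
    R ∈ LinearMap.range (TensorProduct.map B.val.toLinearMap B.val.toLinearMap) → B = ⊤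

end Triangular

/-! ### Data and the Hopf algebra of a datum -/

/-- A datum `(G, F, n)`: a non-degenerate skew symmetric bilinear form `F : G × G → kˣ`
and a function `n : I_F → ℕ`, where `I_F = {g | F(g,g) = -1}`. -/
structure Datum (k : Type u) [Field k] (G : Type w) [CommGroup G] where
  /-- The form; it is also the map `f : G → G^*`, `⟨f(g), h⟩ = F(g,h)`. -/
  F : G →* (G →* kˣ)
  skew : ∀ x y : G, F x y = (F y x)⁻¹
  nondegenerate : Function.Bijective F
  n : {g : G // F g g = -1} → ℕ

namespace Datum

variable {k : Type u} [Field k] {G : Type w} [CommGroup G] (D : Datum k G)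

/-- The set `I_F`. -/
abbrev IF : Type w := {g : G // D.F g g = -1}

/-- The vector space `V_g` of dimension `n_g`. -/
abbrev V (g : D.IF) : Type u := Fin (D.n g) → k

/-- The generators of `H(D)`: the elements of `G` and of the spaces `V_g`. -/
abbrev Gen : Type (max u w) := G ⊕ (Σ g : D.IF, D.V g)

/-- The generator of the free algebra that belongs to `a ∈ G`. -/
abbrev genG (a : G) : FreeAlgebra k D.Gen := FreeAlgebra.ι k (Sum.inl a)

/-- The generator of the free algebra that belongs to `x ∈ V_g`. -/
abbrev genV (g : D.IF) (x : D.V g) : FreeAlgebra k D.Gen := FreeAlgebra.ι k (Sum.inr ⟨g, x⟩)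

/-- The defining relations of `H(D)`. -/
inductive Rel : FreeAlgebra k D.Gen → FreeAlgebra k D.Gen → Prop
  /-- the relations of the group `G` -/
  | one : Rel (D.genG 1) 1
  | mul (a b : G) : Rel (D.genG (a * b)) (D.genG a * D.genG b)
  /-- the relations of the vector space `V_g` -/
  | add (g : D.IF) (x y : D.V g) : Rel (D.genV g (x + y)) (D.genV g x + D.genV g y)
  | smul (g : D.IF) (c : k) (x : D.V g) : Rel (D.genV g (c • x)) (c • D.genV g x)
  /-- `x y = F(h,g) y x` for `x ∈ V_g`, `y ∈ V_h` -/
  | vec_vec (g h : D.IF) (x : D.V g) (y : D.V h) :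
      Rel (D.genV g x * D.genV h y) ((D.F h g : k) • (D.genV h y * D.genV g x))
  /-- `x a = F(a,g) a x` for `x ∈ V_g`, `a ∈ G` -/
  | vec_grp (g : D.IF) (x : D.V g) (a : G) :
      Rel (D.genV g x * D.genG a) ((D.F a g : k) • (D.genG a * D.genV g x))

/-- The algebra `H(D)`. -/
def H : Type (max u w) := RingQuot D.Rel

instance : Ring D.H := inferInstanceAs (Ring (RingQuot D.Rel))

instance : Algebra k D.H := inferInstanceAs (Algebra k (RingQuot D.Rel))

/-- The quotient map from the free algebra. -/
def proj : FreeAlgebra k D.Gen →ₐ[k] D.H := RingQuot.mkAlgHom k D.Rel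

theorem proj_rel {x y : FreeAlgebra k D.Gen} (h : D.Rel x y) : D.proj x = D.proj y :=
  RingQuot.mkAlgHom_rel k h

/-- The canonical map `G → H(D)`. -/
def ofG : G →* D.H where
  toFun a := D.proj (D.genG a)
  map_one' := by rw [D.proj_rel Rel.one, map_one]
  map_mul' a b := by rw [D.proj_rel (Rel.mul a b), map_mul]

/-- The canonical map `V_g → H(D)`. -/
def ofV (g : D.IF) : D.V g →ₗ[k] D.H where
  toFun x := D.proj (D.genV g x)
  map_add' x y := by rw [D.proj_rel (Rel.add g x y), map_add]
  map_smul' c x := by rw [D.proj_rel (Rel.smul g c x), map_smul]; rfl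

theorem ofV_mul_ofV (g h : D.IF) (x : D.V g) (y : D.V h) :
    D.ofV g x * D.ofV h y = (D.F h g : k) • (D.ofV h y * D.ofV g x) := by
  have := D.proj_rel (Rel.vec_vec g h x y)
  rwa [map_mul, map_smul, map_mul] at this

theorem ofV_mul_ofG (g : D.IF) (x : D.V g) (a : G) :
    D.ofV g x * D.ofG a = (D.F a g : k) • (D.ofG a * D.ofV g x) := by
  have := D.proj_rel (Rel.vec_grp g x a)
  rwa [map_mul, map_smul, map_mul] at this

/-- The universal property of `H(D)`. -/
def lift {B : Type*} [Ring B] [Algebra k B] (φ : G →* B) (ψ : ∀ g : D.IF, D.V g →ₗ[k] B)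
    (h₁ : ∀ (g h : D.IF) (x : D.V g) (y : D.V h),
      ψ g x * ψ h y = (D.F h g : k) • (ψ h y * ψ g x))
    (h₂ : ∀ (g : D.IF) (x : D.V g) (a : G), ψ g x * φ a = (D.F a g : k) • (φ a * ψ g x)) :
    D.H →ₐ[k] B :=
  RingQuot.liftAlgHom k ⟨FreeAlgebra.lift k (Sum.elim φ fun y => ψ y.1 y.2), by
    intro x y h
    induction h with
    | one => simp
    | mul a b => simp
    | add g x y => simp
    | smul g c x => simp
    | vec_vec g h x y => simpa using h₁ g h x y
    | vec_grp g x a => simpa using h₂ g x a⟩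

section lift

variable {B : Type*} [Ring B] [Algebra k B] (φ : G →* B) (ψ : ∀ g : D.IF, D.V g →ₗ[k] B)
    (h₁ : ∀ (g h : D.IF) (x : D.V g) (y : D.V h),
      ψ g x * ψ h y = (D.F h g : k) • (ψ h y * ψ g x))
    (h₂ : ∀ (g : D.IF) (x : D.V g) (a : G), ψ g x * φ a = (D.F a g : k) • (φ a * ψ g x))

@[simp] theorem lift_ofG (a : G) : D.lift φ ψ h₁ h₂ (D.ofG a) = φ a := by
  change RingQuot.liftAlgHom k _ (RingQuot.mkAlgHom k D.Rel _) = _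
  rw [RingQuot.liftAlgHom_mkAlgHom_apply]
  simp

@[simp] theorem lift_ofV (g : D.IF) (x : D.V g) :
    D.lift φ ψ h₁ h₂ (D.ofV g x) = ψ g x := by
  change RingQuot.liftAlgHom k _ (RingQuot.mkAlgHom k D.Rel _) = _
  rw [RingQuot.liftAlgHom_mkAlgHom_apply]
  simp

end lift

theorem induction {P : D.H → Prop} (hc : ∀ c : k, P (algebraMap k D.H c))
    (hG : ∀ a : G, P (D.ofG a)) (hV : ∀ (g : D.IF) (x : D.V g), P (D.ofV g x))
    (hadd : ∀ x y, P x → P y → P (x + y)) (hmul : ∀ x y, P x → P y → P (x * y)) (x : D.H) :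
    P x := by
  obtain ⟨y, rfl⟩ : ∃ y, D.proj y = x := RingQuot.mkAlgHom_surjective k D.Rel x
  induction y with
  | grade0 c => rw [AlgHom.commutes]; exact hc c
  | grade1 s =>
    rcases s with a | ⟨g, x⟩
    · exact hG a
    · exact hV g x
  | mul a b ha hb => rw [map_mul]; exact hmul _ _ ha hb
  | add a b ha hb => rw [map_add]; exact hadd _ _ ha hb

theorem algHom_ext {B : Type*} [Ring B] [Algebra k B] {f f' : D.H →ₐ[k] B}
    (hG : ∀ a : G, f (D.ofG a) = f' (D.ofG a))
    (hV : ∀ (g : D.IF) (x : D.V g), f (D.ofV g x) = f' (D.ofV g x)) : f = f' := by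
  apply AlgHom.ext
  refine D.induction ?_ ?_ ?_ ?_ ?_
  · intro c; simp
  · exact hG
  · exact hV
  · intro x y hx hy; simp [hx, hy]
  · intro x y hx hy; simp [hx, hy]

/-! #### The coalgebra structure -/

theorem F_mul_F (g h : G) : (D.F g h : k) * (D.F h g : k) = 1 := by
  rw [D.skew g h, ← Units.val_mul, inv_mul_cancel, Units.val_one]

/-- The map `a ↦ a ⊗ a` on `G`. -/
def diagG : G →* D.H ⊗[k] D.H where
  toFun a := D.ofG a ⊗ₜ D.ofG a
  map_one' := by simp [Algebra.TensorProduct.one_def]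
  map_mul' a b := by simp

@[simp] theorem diagG_apply (a : G) : D.diagG a = D.ofG a ⊗ₜ[k] D.ofG a := rfl

/-- The coproduct of `H(D)`: `a ∈ G` is grouplike and `Δ(x) = x ⊗ 1 + g ⊗ x` for `x ∈ V_g`. -/
def comulHom : D.H →ₐ[k] D.H ⊗[k] D.H :=
  D.lift D.diagG
    (fun g => (TensorProduct.mk k D.H D.H).flip 1 ∘ₗ D.ofV g +
      TensorProduct.mk k D.H D.H (D.ofG g) ∘ₗ D.ofV g)
    (by
      intro g h x y
      simp only [LinearMap.add_apply, LinearMap.comp_apply, LinearMap.flip_apply,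
        TensorProduct.mk_apply, add_mul, mul_add, Algebra.TensorProduct.tmul_mul_tmul, mul_one,
        one_mul, D.ofV_mul_ofV g h x y, D.ofV_mul_ofG, ← map_mul, smul_add,
        TensorProduct.smul_tmul', TensorProduct.tmul_smul, smul_smul, D.F_mul_F, one_smul,
        mul_comm (h : G) (g : G)]
      abel)
    (by
      intro g x a
      simp only [LinearMap.add_apply, LinearMap.comp_apply, LinearMap.flip_apply, diagG_apply,
        TensorProduct.mk_apply, add_mul, mul_add, Algebra.TensorProduct.tmul_mul_tmul, mul_one,
        one_mul, D.ofV_mul_ofG, ← map_mul, smul_add,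
        TensorProduct.smul_tmul', TensorProduct.tmul_smul, mul_comm a (g : G)])

@[simp] theorem comulHom_ofG (a : G) : D.comulHom (D.ofG a) = D.ofG a ⊗ₜ D.ofG a := by
  simp [comulHom]

@[simp] theorem comulHom_ofV (g : D.IF) (x : D.V g) :
    D.comulHom (D.ofV g x) = D.ofV g x ⊗ₜ 1 + D.ofG g ⊗ₜ D.ofV g x := by
  simp [comulHom]

/-- The extension of a character `α` of `G` to `H(D)` by zero on all `V_g`. -/
def charHom (α : G →* kˣ) : D.H →ₐ[k] k :=
  D.lift ((Units.coeHom k).comp α) (fun _ => 0) (by simp) (by simp)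

@[simp] theorem charHom_ofG (α : G →* kˣ) (a : G) : D.charHom α (D.ofG a) = (α a : k) := by
  simp [charHom]

@[simp] theorem charHom_ofV (α : G →* kˣ) (g : D.IF) (x : D.V g) :
    D.charHom α (D.ofV g x) = 0 := by
  simp [charHom]

instance : Bialgebra k D.H :=
  Bialgebra.ofAlgHom D.comulHom (D.charHom 1)
    (by
      apply D.algHom_ext
      · intro a; simp
      · intro g x
        simp [TensorProduct.add_tmul, TensorProduct.tmul_add, Algebra.TensorProduct.one_def,
          add_assoc])
    (by
      apply D.algHom_ext
      · intro a; simp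
      · intro g x; simp)
    (by
      apply D.algHom_ext
      · intro a; simp
      · intro g x; simp)

@[simp] theorem comul_ofG (a : G) :
    Coalgebra.comul (R := k) (D.ofG a) = D.ofG a ⊗ₜ D.ofG a := D.comulHom_ofG a

@[simp] theorem comul_ofV (g : D.IF) (x : D.V g) :
    Coalgebra.comul (R := k) (D.ofV g x) = D.ofV g x ⊗ₜ 1 + D.ofG g ⊗ₜ D.ofV g x :=
  D.comulHom_ofV g x

@[simp] theorem counit_ofG (a : G) : Coalgebra.counit (R := k) (D.ofG a) = 1 := by
  change D.charHom 1 _ = _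
  simp

@[simp] theorem counit_ofV (g : D.IF) (x : D.V g) :
    Coalgebra.counit (R := k) (D.ofV g x) = 0 := by
  change D.charHom 1 _ = _
  simp

/-! #### The antipode -/

section anti

variable {A : Type*} [Ring A] [Algebra k A] (S : A →ₐ[k] Aᵐᵒᵖ)

/-- An algebra homomorphism `A → A^{op}` as a linear endomorphism of `A`. -/
def unopLin : A →ₗ[k] A := (MulOpposite.opLinearEquiv k).symm.toLinearMap ∘ₗ S.toLinearMap

theorem unopLin_apply (a : A) : unopLin S a = (S a).unop := rfl

theorem mul_rTensor_mul {s t : A ⊗[k] A} {c d : k}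
    (hs : LinearMap.mul' k A ((unopLin S).rTensor A s) = algebraMap k A c)
    (ht : LinearMap.mul' k A ((unopLin S).rTensor A t) = algebraMap k A d) :
    LinearMap.mul' k A ((unopLin S).rTensor A (s * t)) = algebraMap k A (c * d) := by
  have h1 : ∀ (s : A ⊗[k] A) (u v : A),
      LinearMap.mul' k A ((unopLin S).rTensor A (s * u ⊗ₜ v)) =
      unopLin S u * LinearMap.mul' k A ((unopLin S).rTensor A s) * v := by
    intro s u v
    induction s with
    | zero => simp
    | add x y hx hy => simp only [add_mul, map_add, hx, hy, mul_add]
    | tmul p q => simp [unopLin_apply, mul_assoc]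
  have h2 : ∀ t : A ⊗[k] A, LinearMap.mul' k A ((unopLin S).rTensor A (s * t)) =
      c • LinearMap.mul' k A ((unopLin S).rTensor A t) := by
    intro t
    induction t with
    | zero => simp
    | add x y hx hy => simp only [mul_add, map_add, hx, hy, smul_add]
    | tmul u v =>
      rw [h1, hs, Algebra.algebraMap_eq_smul_one]
      simp
  rw [h2, ht, Algebra.smul_def, map_mul]

theorem mul_lTensor_mul {s t : A ⊗[k] A} {c d : k}
    (hs : LinearMap.mul' k A ((unopLin S).lTensor A s) = algebraMap k A c)
    (ht : LinearMap.mul' k A ((unopLin S).lTensor A t) = algebraMap k A d) :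
    LinearMap.mul' k A ((unopLin S).lTensor A (s * t)) = algebraMap k A (c * d) := by
  have h1 : ∀ (t : A ⊗[k] A) (u v : A),
      LinearMap.mul' k A ((unopLin S).lTensor A (u ⊗ₜ v * t)) =
      u * LinearMap.mul' k A ((unopLin S).lTensor A t) * unopLin S v := by
    intro t u v
    induction t with
    | zero => simp
    | add x y hx hy => simp only [add_mul, map_add, hx, hy, mul_add]
    | tmul p q => simp [unopLin_apply, mul_assoc]
  have h2 : ∀ s : A ⊗[k] A, LinearMap.mul' k A ((unopLin S).lTensor A (s * t)) =
      d • LinearMap.mul' k A ((unopLin S).lTensor A s) := by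
    intro s
    induction s with
    | zero => simp
    | add x y hx hy => simp only [add_mul, map_add, hx, hy, smul_add]
    | tmul u v =>
      rw [h1, ht, Algebra.algebraMap_eq_smul_one]
      simp
  rw [h2, hs, Algebra.smul_def, ← map_mul, mul_comm]

end anti

theorem rTensor_eq_counit (S : D.H →ₐ[k] D.Hᵐᵒᵖ) (δ : D.H →ₐ[k] D.H ⊗[k] D.H)
    (hG : ∀ a, LinearMap.mul' k D.H ((unopLin S).rTensor D.H (δ (D.ofG a))) = 1)
    (hV : ∀ g x, LinearMap.mul' k D.H ((unopLin S).rTensor D.H (δ (D.ofV g x))) = 0) :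
    LinearMap.mul' k D.H ∘ₗ (unopLin S).rTensor D.H ∘ₗ δ.toLinearMap =
      Algebra.linearMap k D.H ∘ₗ Coalgebra.counit := by
  apply LinearMap.ext
  refine D.induction ?_ ?_ ?_ ?_ ?_
  · intro c
    simp [unopLin_apply, Algebra.TensorProduct.algebraMap_apply]
  · intro a; simpa using hG a
  · intro g x; simpa using hV g x
  · intro x y hx hy; simp only [map_add, hx, hy]
  · intro x y hx hy
    simp only [LinearMap.comp_apply, AlgHom.toLinearMap_apply, Algebra.linearMap_apply,
      map_mul, Bialgebra.counit_mul] at hx hy ⊢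
    rw [mul_rTensor_mul S hx hy, map_mul]

theorem lTensor_eq_counit (S : D.H →ₐ[k] D.Hᵐᵒᵖ) (δ : D.H →ₐ[k] D.H ⊗[k] D.H)
    (hG : ∀ a, LinearMap.mul' k D.H ((unopLin S).lTensor D.H (δ (D.ofG a))) = 1)
    (hV : ∀ g x, LinearMap.mul' k D.H ((unopLin S).lTensor D.H (δ (D.ofV g x))) = 0) :
    LinearMap.mul' k D.H ∘ₗ (unopLin S).lTensor D.H ∘ₗ δ.toLinearMap =
      Algebra.linearMap k D.H ∘ₗ Coalgebra.counit := by
  apply LinearMap.ext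
  refine D.induction ?_ ?_ ?_ ?_ ?_
  · intro c
    simp [unopLin_apply, Algebra.TensorProduct.algebraMap_apply]
  · intro a; simpa using hG a
  · intro g x; simpa using hV g x
  · intro x y hx hy; simp only [map_add, hx, hy]
  · intro x y hx hy
    simp only [LinearMap.comp_apply, AlgHom.toLinearMap_apply, Algebra.linearMap_apply,
      map_mul, Bialgebra.counit_mul] at hx hy ⊢
    rw [mul_lTensor_mul S hx hy, map_mul]

/-- The map `a ↦ a⁻¹` from `G` to `H(D)^{op}`. -/
def invG : G →* D.Hᵐᵒᵖ where
  toFun a := MulOpposite.op (D.ofG a⁻¹)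
  map_one' := by simp
  map_mul' a b := by rw [← MulOpposite.op_mul, ← map_mul, mul_inv_rev]

@[simp] theorem invG_apply (a : G) : D.invG a = MulOpposite.op (D.ofG a⁻¹) := rfl

theorem ofV_mul_ofG_mul (g : D.IF) (x : D.V g) (a : G) (z : D.H) :
    D.ofV g x * (D.ofG a * z) = (D.F a g : k) • (D.ofG a * (D.ofV g x * z)) := by
  rw [← mul_assoc, ofV_mul_ofG, smul_mul_assoc, mul_assoc]

theorem ofG_mul_ofG_mul (a b : G) (z : D.H) :
    D.ofG a * (D.ofG b * z) = D.ofG (a * b) * z := by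
  rw [← mul_assoc, ← map_mul]

theorem F_inv_left (g h : G) : (D.F g⁻¹ h : k) = (D.F h g : k) := by
  rw [map_inv, MonoidHom.inv_apply, ← D.skew h g]

/-- The antipode of `H(D)`: `a ↦ a⁻¹` and `x ↦ - g⁻¹ x` for `x ∈ V_g`. -/
def antipodeHom : D.H →ₐ[k] D.Hᵐᵒᵖ :=
  D.lift D.invG
    (fun g => -((MulOpposite.opLinearEquiv k).toLinearMap ∘ₗ
      LinearMap.mulLeft k (D.ofG (g : G)⁻¹) ∘ₗ D.ofV g))
    (by
      intro g h x y
      apply MulOpposite.unop_injective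
      simp only [LinearMap.neg_apply, LinearMap.comp_apply, LinearEquiv.coe_coe,
        MulOpposite.coe_opLinearEquiv, LinearMap.mulLeft_apply, neg_mul_neg, MulOpposite.unop_mul,
        MulOpposite.unop_op, MulOpposite.unop_smul, mul_assoc, D.ofV_mul_ofG_mul,
        D.ofV_mul_ofV g h x y, mul_smul_comm, F_inv_left, smul_smul]
      rw [D.ofG_mul_ofG_mul, D.ofG_mul_ofG_mul, mul_comm (h : G)⁻¹ (g : G)⁻¹, D.F_mul_F, mul_one])
    (by
      intro g x a
      apply MulOpposite.unop_injective
      simp only [LinearMap.neg_apply, LinearMap.comp_apply, LinearEquiv.coe_coe,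
        MulOpposite.coe_opLinearEquiv, LinearMap.mulLeft_apply, MulOpposite.unop_mul, invG_apply,
        MulOpposite.unop_op, MulOpposite.unop_smul, mul_assoc, D.ofV_mul_ofG,
        mul_smul_comm, F_inv_left, smul_smul, mul_neg, neg_mul, MulOpposite.unop_neg, smul_neg,
        D.F_mul_F, one_smul]
      rw [← mul_assoc, ← map_mul, ← mul_assoc, ← map_mul, mul_comm a⁻¹ (g : G)⁻¹])

/-- The inverse of the antipode of `H(D)`: `a ↦ a⁻¹` and `x ↦ - x g⁻¹` for `x ∈ V_g`. -/
def skewAntipodeHom : D.H →ₐ[k] D.Hᵐᵒᵖ :=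
  D.lift D.invG
    (fun g => -((MulOpposite.opLinearEquiv k).toLinearMap ∘ₗ
      LinearMap.mulRight k (D.ofG (g : G)⁻¹) ∘ₗ D.ofV g))
    (by
      intro g h x y
      apply MulOpposite.unop_injective
      simp only [LinearMap.neg_apply, LinearMap.comp_apply, LinearEquiv.coe_coe,
        MulOpposite.coe_opLinearEquiv, LinearMap.mulRight_apply, neg_mul_neg,
        MulOpposite.unop_mul, MulOpposite.unop_op, MulOpposite.unop_smul, mul_assoc,
        D.ofV_mul_ofG_mul, D.ofV_mul_ofG, D.ofV_mul_ofV g h x y, mul_smul_comm, F_inv_left,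
        smul_smul, smul_mul_assoc]
      rw [D.ofG_mul_ofG_mul, D.ofG_mul_ofG_mul, mul_comm (h : G)⁻¹ (g : G)⁻¹]
      congr 1
      have h1 := D.F_mul_F g h
      linear_combination (- D.F g g * D.F h h * D.F h g : k) * h1)
    (by
      intro g x a
      apply MulOpposite.unop_injective
      simp only [LinearMap.neg_apply, LinearMap.comp_apply, LinearEquiv.coe_coe,
        MulOpposite.coe_opLinearEquiv, LinearMap.mulRight_apply, MulOpposite.unop_mul, invG_apply,
        MulOpposite.unop_op, MulOpposite.unop_smul, mul_assoc, D.ofV_mul_ofG,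
        mul_smul_comm, F_inv_left, smul_smul, mul_neg, neg_mul, MulOpposite.unop_neg, smul_neg,
        smul_mul_assoc]
      rw [D.ofG_mul_ofG_mul, D.ofG_mul_ofG_mul, mul_comm a⁻¹ (g : G)⁻¹]
      congr 2
      have h1 := D.F_mul_F g a
      linear_combination (- D.F g g : k) * h1)

@[simp] theorem unopLin_antipodeHom_ofG (a : G) : unopLin D.antipodeHom (D.ofG a) = D.ofG a⁻¹ := by
  simp [unopLin_apply, antipodeHom]

@[simp] theorem unopLin_antipodeHom_ofV (g : D.IF) (x : D.V g) :
    unopLin D.antipodeHom (D.ofV g x) = -(D.ofG (g : G)⁻¹ * D.ofV g x) := by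
  simp [unopLin_apply, antipodeHom]

@[simp] theorem unopLin_skewAntipodeHom_ofG (a : G) :
    unopLin D.skewAntipodeHom (D.ofG a) = D.ofG a⁻¹ := by
  simp [unopLin_apply, skewAntipodeHom]

@[simp] theorem unopLin_skewAntipodeHom_ofV (g : D.IF) (x : D.V g) :
    unopLin D.skewAntipodeHom (D.ofV g x) = -(D.ofV g x * D.ofG (g : G)⁻¹) := by
  simp [unopLin_apply, skewAntipodeHom]

theorem unopLin_one {A : Type*} [Ring A] [Algebra k A] (S : A →ₐ[k] Aᵐᵒᵖ) :
    unopLin S 1 = 1 := by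
  simp [unopLin_apply]

/-- `H(D)` is a Hopf algebra. -/
instance : HopfAlgebra k D.H where
  antipode := unopLin D.antipodeHom
  mul_antipode_rTensor_comul := by
    refine D.rTensor_eq_counit D.antipodeHom D.comulHom ?_ ?_
    · intro a; simp [← map_mul]
    · intro g x; simp
  mul_antipode_lTensor_comul := by
    refine D.lTensor_eq_counit D.antipodeHom D.comulHom ?_ ?_
    · intro a; simp [← map_mul]
    · intro g x; simp [unopLin_one, ← mul_assoc, ← map_mul]

/-! #### Finite-dimensionality -/

section finite

/-- The linear span of `G` in `H(D)`. -/
def spanG : Submodule k D.H := Submodule.span k (Set.range D.ofG)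

/-- The linear span of `1` and the `i`-th basis vector of `V_g` in `H(D)`. -/
def spanV (i : Σ g : D.IF, Fin (D.n g)) : Submodule k D.H :=
  Submodule.span k {1, D.ofV i.1 (Pi.single i.2 1)}

theorem one_mem_spanG : (1 : D.H) ∈ D.spanG :=
  Submodule.subset_span ⟨1, map_one _⟩

theorem ofG_mem_spanG (a : G) : D.ofG a ∈ D.spanG := Submodule.subset_span ⟨a, rfl⟩

theorem one_mem_spanV (i : Σ g : D.IF, Fin (D.n g)) : (1 : D.H) ∈ D.spanV i :=
  Submodule.subset_span (by simp)

theorem spanG_mul_spanG : D.spanG * D.spanG ≤ D.spanG := by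
  rw [spanG, Submodule.span_mul_span, Submodule.span_le]
  rintro _ ⟨_, ⟨a, rfl⟩, _, ⟨b, rfl⟩, rfl⟩
  exact Submodule.subset_span ⟨a * b, map_mul _ _ _⟩

theorem commute_spanG_spanV (i : Σ g : D.IF, Fin (D.n g)) : Commute D.spanG (D.spanV i) := by
  apply le_antisymm
  · conv_lhs => rw [spanG, spanV, Submodule.span_mul_span]
    rw [Submodule.span_le]
    rintro _ ⟨_, ⟨a, rfl⟩, y, hy, rfl⟩
    rcases hy with rfl | rfl
    · simpa using Submodule.mul_mem_mul (D.one_mem_spanV i) (D.ofG_mem_spanG a)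
    · have h := D.ofV_mul_ofG i.1 (Pi.single i.2 1) a
      have h2 : D.ofG a * D.ofV i.1 (Pi.single i.2 1) =
          (D.F i.1 a : k) • (D.ofV i.1 (Pi.single i.2 1) * D.ofG a) := by
        rw [h, smul_smul, D.F_mul_F, one_smul]
      change D.ofG a * D.ofV i.1 (Pi.single i.2 1) ∈ _
      rw [h2]
      exact Submodule.smul_mem _ _ (Submodule.mul_mem_mul (Submodule.subset_span (by simp))
        (Submodule.subset_span ⟨a, rfl⟩))
  · conv_lhs => rw [spanG, spanV, Submodule.span_mul_span]
    rw [Submodule.span_le]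
    rintro _ ⟨y, hy, _, ⟨a, rfl⟩, rfl⟩
    rcases hy with rfl | rfl
    · simpa using Submodule.mul_mem_mul (D.ofG_mem_spanG a) (D.one_mem_spanV i)
    · change D.ofV i.1 (Pi.single i.2 1) * D.ofG a ∈ _
      rw [D.ofV_mul_ofG]
      exact Submodule.smul_mem _ _ (Submodule.mul_mem_mul (Submodule.subset_span ⟨a, rfl⟩)
        (Submodule.subset_span (by simp)))

theorem spanV_mul_le (i j : Σ g : D.IF, Fin (D.n g)) :
    D.spanV i * D.spanV j ≤ D.spanV j * D.spanV i := by
  conv_lhs => rw [spanV, spanV, Submodule.span_mul_span]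
  rw [Submodule.span_le]
  have hi : D.ofV i.1 (Pi.single i.2 1) ∈ D.spanV i := Submodule.subset_span (by simp)
  have hj : D.ofV j.1 (Pi.single j.2 1) ∈ D.spanV j := Submodule.subset_span (by simp)
  rintro _ ⟨x, hx, y, hy, rfl⟩
  rcases hx with rfl | rfl <;> rcases hy with rfl | rfl
  · exact Submodule.mul_mem_mul (D.one_mem_spanV j) (D.one_mem_spanV i)
  · simpa using Submodule.mul_mem_mul hj (D.one_mem_spanV i)
  · simpa using Submodule.mul_mem_mul (D.one_mem_spanV j) hi
  · change D.ofV i.1 (Pi.single i.2 1) * D.ofV j.1 (Pi.single j.2 1) ∈ _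
    rw [D.ofV_mul_ofV]
    exact Submodule.smul_mem _ _ (Submodule.mul_mem_mul hj hi)

theorem commute_spanV_spanV (i j : Σ g : D.IF, Fin (D.n g)) :
    Commute (D.spanV i) (D.spanV j) :=
  le_antisymm (D.spanV_mul_le i j) (D.spanV_mul_le j i)

variable [CharZero k]

theorem ofV_mul_self (g : D.IF) (x : D.V g) : D.ofV g x * D.ofV g x = 0 := by
  have h := D.ofV_mul_ofV g g x x
  rw [g.2, Units.val_neg, Units.val_one, neg_one_smul] at h
  have h2 : (2 : k) • (D.ofV g x * D.ofV g x) = 0 := by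
    rw [two_smul]; nth_rewrite 1 [h]; exact neg_add_cancel _
  exact (smul_eq_zero.mp h2).resolve_left two_ne_zero

theorem spanV_mul_spanV (i : Σ g : D.IF, Fin (D.n g)) :
    D.spanV i * D.spanV i ≤ D.spanV i := by
  conv_lhs => rw [spanV, Submodule.span_mul_span]
  rw [Submodule.span_le]
  have hi : D.ofV i.1 (Pi.single i.2 1) ∈ D.spanV i := Submodule.subset_span (by simp)
  rintro _ ⟨x, hx, y, hy, rfl⟩
  rcases hx with rfl | rfl <;> rcases hy with rfl | rfl
  · simpa using D.one_mem_spanV i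
  · simpa using hi
  · simpa using hi
  · change D.ofV i.1 (Pi.single i.2 1) * D.ofV i.1 (Pi.single i.2 1) ∈ _
    rw [D.ofV_mul_self]
    exact Submodule.zero_mem _

variable [Finite G]

/-- `H(D)` is finite-dimensional. -/
instance : Module.Finite k D.H := by
  classical
  have : Fintype (Σ g : D.IF, Fin (D.n g)) := Fintype.ofFinite _
  let l : List (Σ g : D.IF, Fin (D.n g)) := Finset.univ.toList
  let W : Submodule k D.H := D.spanG * (l.map D.spanV).prod
  have one_prod : ∀ l : List (Σ g : D.IF, Fin (D.n g)), (1 : D.H) ∈ (l.map D.spanV).prod := by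
    intro l
    induction l with
    | nil => simpa using Submodule.one_le.mp (le_refl (1 : Submodule k D.H))
    | cons i l ih => simpa using Submodule.mul_mem_mul (D.one_mem_spanV i) ih
  have hfg : ∀ l : List (Σ g : D.IF, Fin (D.n g)), (l.map D.spanV).prod.FG := by
    intro l
    induction l with
    | nil => exact ⟨{1}, by simp [Submodule.one_eq_span]⟩
    | cons i l ih =>
      simp only [List.map_cons, List.prod_cons]
      exact Submodule.FG.mul (Submodule.fg_span (by simp)) ih
  have hV : ∀ i ∈ l, D.spanV i * W ≤ W := by
    intro i hi
    have key : ∀ l : List (Σ g : D.IF, Fin (D.n g)), i ∈ l →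
        D.spanV i * (l.map D.spanV).prod ≤ (l.map D.spanV).prod := by
      intro l
      induction l with
      | nil => simp
      | cons j l ih =>
        intro h
        simp only [List.map_cons, List.prod_cons]
        by_cases e : i = j
        · subst e
          rw [← mul_assoc]
          exact mul_le_mul' (D.spanV_mul_spanV i) le_rfl
        · rw [← mul_assoc, (D.commute_spanV_spanV i j).eq, mul_assoc]
          exact mul_le_mul' le_rfl (ih (by simpa [e] using h))
    change D.spanV i * (D.spanG * _) ≤ D.spanG * _
    rw [← mul_assoc, ← (D.commute_spanG_spanV i).eq, mul_assoc]
    exact mul_le_mul' le_rfl (key l hi)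
  have hG : D.spanG * W ≤ W := by
    change D.spanG * (D.spanG * _) ≤ D.spanG * _
    rw [← mul_assoc]
    exact mul_le_mul' D.spanG_mul_spanG le_rfl
  have hx : ∀ x : D.H, ∀ w ∈ W, x * w ∈ W := by
    refine D.induction ?_ ?_ ?_ ?_ ?_
    · intro c w hw
      rw [← Algebra.smul_def]; exact W.smul_mem _ hw
    · intro a w hw
      exact hG (Submodule.mul_mem_mul (Submodule.subset_span ⟨a, rfl⟩) hw)
    · intro g x w hw
      have hb : x = ∑ i, x i • (Pi.single i 1 : D.V g) := by
        simpa using (Pi.basisFun k (Fin (D.n g))).sum_repr x |>.symm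
      rw [hb, map_sum, Finset.sum_mul]
      refine W.sum_mem fun i _ => ?_
      rw [map_smul, smul_mul_assoc]
      exact W.smul_mem _ (hV ⟨g, i⟩ (by simp [l])
        (Submodule.mul_mem_mul (Submodule.subset_span (by simp)) hw))
    · intro x y hx hy w hw
      rw [add_mul]; exact W.add_mem (hx w hw) (hy w hw)
    · intro x y hx hy w hw
      rw [mul_assoc]; exact hx _ (hy w hw)
  have h1 : (1 : D.H) ∈ W := by
    simpa [W] using Submodule.mul_mem_mul D.one_mem_spanG (one_prod l)
  have htop : W = ⊤ := by
    rw [eq_top_iff]; intro x _; simpa using hx x 1 h1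
  refine ⟨?_⟩
  rw [← htop]
  exact Submodule.FG.mul (Submodule.fg_span (Set.finite_range _)) (hfg l)

/-- The Hopf algebra `H(D)^{*cop}`. -/
instance : HopfAlgebra k (DualCop k D.H) :=
  DualCop.hopfOfSkewAntipode (unopLin D.skewAntipodeHom)
    (by
      refine D.lTensor_eq_counit D.skewAntipodeHom
        ((Algebra.TensorProduct.comm k D.H D.H).toAlgHom.comp D.comulHom) ?_ ?_
      · intro a; simp [← map_mul]
      · intro g x; simp)
    (by
      refine D.rTensor_eq_counit D.skewAntipodeHom
        ((Algebra.TensorProduct.comm k D.H D.H).toAlgHom.comp D.comulHom) ?_ ?_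
      · intro a; simp [← map_mul]
      · intro g x; simp [unopLin_one, mul_assoc, ← map_mul])

end finite

/-! #### The functionals `P_x`, and the parameter sets `Φ` and `S(k)` -/

open scoped Classical in
/-- For `x ∈ V_g^*`, the functional `y ↦ δ_{g,h} ⟨x, y⟩` on `V_h`. -/
def pairing (g : D.IF) (x : Module.Dual k (D.V g)) (h : D.IF) : Module.Dual k (D.V h) :=
  x ∘ₗ LinearMap.proj g ∘ₗ LinearMap.single k D.V h

theorem pairing_self (g : D.IF) (x : Module.Dual k (D.V g)) (y : D.V g) :
    D.pairing g x g y = x y := by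
  simp [pairing]

theorem pairing_ne (g h : D.IF) (hgh : g ≠ h) (x : Module.Dual k (D.V g)) (y : D.V h) :
    D.pairing g x h y = 0 := by
  classical
  have : D.pairing g x h y = x (Pi.single h y g) := by
    unfold pairing
    simp only [LinearMap.comp_apply, LinearMap.proj_apply, LinearMap.single_apply]
  rw [this, Pi.single_eq_of_ne hgh, map_zero]

/-- The representation `a ↦ diag(1, F(a,g))`, `y ↦ δ_{g,h} ⟨x, y⟩ E₁₂` (`a ∈ G`, `y ∈ V_h`)
of `H(D)` on `k²`. -/
def rep (g : D.IF) (x : Module.Dual k (D.V g)) : D.H →ₐ[k] Matrix (Fin 2) (Fin 2) k :=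
  D.lift
    { toFun := fun a => !![1, 0; 0, (D.F a g : k)]
      map_one' := by ext i j; fin_cases i <;> fin_cases j <;> simp
      map_mul' := fun a b => by ext i j; fin_cases i <;> fin_cases j <;> simp }
    (fun h => LinearMap.toSpanSingleton k (Matrix (Fin 2) (Fin 2) k) !![0, 1; 0, 0] ∘ₗ
      D.pairing g x h)
    (by intro h h' y y'; ext i j; fin_cases i <;> fin_cases j <;> simp)
    (by
      intro h y a
      by_cases e : g = h
      · subst e; ext i j; fin_cases i <;> fin_cases j <;> simp [mul_comm]
      · simp [D.pairing_ne g h e])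

theorem rep_ofG (g : D.IF) (x : Module.Dual k (D.V g)) (a : G) :
    D.rep g x (D.ofG a) = !![1, 0; 0, (D.F a g : k)] := by
  simp [rep]

theorem rep_ofV (g : D.IF) (x : Module.Dual k (D.V g)) (h : D.IF) (y : D.V h) :
    D.rep g x (D.ofV h y) = D.pairing g x h y • !![0, 1; 0, 0] := by
  simp [rep]

/-- The functional `P_x` on `H(D)` for `x ∈ V_g^*`, as a matrix coefficient of the representation
above. It is the functional with `⟨P_x, a y⟩ = δ_{g,h} ⟨x, y⟩` for `a ∈ G`, `y ∈ V_h`, and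
`⟨P_x, a y⟩ = 0` for `a ∈ G` and products `y` of any number other than one of elements of the
spaces `V_h`; see the three lemmas below. As these elements `a y` span `H(D)`, these conditions
determine `P_x`. -/
def P (g : D.IF) (x : Module.Dual k (D.V g)) : Module.Dual k D.H :=
  Matrix.entryLinearMap k k 0 1 ∘ₗ (D.rep g x).toLinearMap

theorem P_apply_self (g : D.IF) (x : Module.Dual k (D.V g)) (a : G) (y : D.V g) :
    D.P g x (D.ofG a * D.ofV g y) = x y := by
  simp [P, rep_ofG, rep_ofV, pairing_self]

theorem P_apply_ne (g h : D.IF) (hgh : g ≠ h) (x : Module.Dual k (D.V g)) (a : G) (y : D.V h) :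
    D.P g x (D.ofG a * D.ofV h y) = 0 := by
  simp [P, rep_ofV, D.pairing_ne g h hgh]

theorem P_apply_of_length_ne_one (g : D.IF) (x : Module.Dual k (D.V g)) (a : G)
    (l : List (Σ h : D.IF, D.V h)) (hl : l.length ≠ 1) :
    D.P g x (D.ofG a * (l.map fun y => D.ofV y.1 y.2).prod) = 0 := by
  match l, hl with
  | [], _ => simp [P, rep_ofG]
  | y :: z :: l, _ =>
    have : D.rep g x (D.ofV y.1 y.2) * D.rep g x (D.ofV z.1 z.2) = 0 := by
      rw [rep_ofV, rep_ofV]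
      ext i j; fin_cases i <;> fin_cases j <;> simp
    simp [P, ← mul_assoc, mul_assoc (D.rep g x (D.ofG a)), this]

/-- The set `Φ` of all isomorphisms `φ : G^* → G` with `φ^*(α) = φ(α⁻¹)` for all `α ∈ G^*`, where
`φ^* : G^* → G^{**} = G`, i.e. `⟨α, φ(β)⟩ = ⟨β, φ(α⁻¹)⟩` for all `α, β ∈ G^*`, and with
`φ(f(g)) = g` for all `g ∈ I_F` with `n_g ≠ 0`. -/
@[ext]
structure Phi where
  φ : (G →* kˣ) ≃* G
  adjoint : ∀ α β : G →* kˣ, α (φ β) = β (φ α⁻¹)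
  fix : ∀ g : D.IF, D.n g ≠ 0 → φ (D.F g) = g

/-- The set `S(k)` of all families of isomorphisms `M_g : V_g^* → V_{g⁻¹}`, for `g ∈ I_F` with
`n_g ≠ 0`, such that `M_g^* = M_{g⁻¹}`. Here `g⁻¹`, which again lies in `I_F`, is written as a
second variable `h ∈ I_F` with `g h = 1`. -/
@[ext]
structure SK where
  M : ∀ g h : D.IF, D.n g ≠ 0 → (g : G) * h = 1 → (Module.Dual k (D.V g) ≃ₗ[k] D.V h)
  adjoint : ∀ (g h : D.IF) (hg : D.n g ≠ 0) (hh : D.n h ≠ 0) (e : (g : G) * h = 1)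
    (e' : (h : G) * g = 1) (x : Module.Dual k (D.V g)) (y : Module.Dual k (D.V h)),
    y (M g h hg e x) = x (M h g hh e' y)

/-- For `g ∈ I_F` also `g⁻¹ ∈ I_F`. -/
theorem exists_inv_IF (g : D.IF) : ∃ h : D.IF, (g : G) * h = 1 :=
  ⟨⟨(g : G)⁻¹, by
    rw [map_inv, map_inv, MonoidHom.inv_apply, inv_inv, g.2]⟩,
    mul_inv_cancel _⟩

/-- The Hopf algebra isomorphism `f : H(D)^{*cop} → H(D)` sends `α` to `φ(α)` for `α ∈ G^*`, and
`P_x` to `M_g(x)` for `x ∈ V_g^*`. -/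
def Sends [CharZero k] [Finite G] (T : D.Phi × D.SK) (f : DualCop k D.H ≃ₐc[k] D.H) : Prop :=
  (∀ α : G →* kˣ, f (DualCop.of (D.charHom α).toLinearMap) = D.ofG (T.1.φ α)) ∧
  ∀ (g h : D.IF) (hg : D.n g ≠ 0) (e : (g : G) * h = 1) (x : Module.Dual k (D.V g)),
    f (DualCop.of (D.P g x)) = D.ofV h (T.2.M g h hg e x)

end Datum

end TriHopf

end

open scoped TensorProduct

noncomputable section

/-! Write `A` for `H(D)`. Since `A` is finite-dimensional, a tensor `R` in `A ⊗ A` is the same thing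
as the linear map `f_R`. The two coproduct axioms say that `f_R` respects products and coproducts
from `A^{*cop}` to `A` (`comul_left_iff`, `comul_right_iff`). Since `(S ⊗ I)(R)` is inverse to `R`,
the axiom `R⁻¹ = R₂₁` becomes the symmetry `⟨S p, f(q)⟩ = ⟨q, f(p)⟩`. The axiom `Δ^{cop}(a) R = R
Δ(a)` becomes a commutation rule between `f`, multiplication by `a` and translates of functionals.
Minimality means that `f_R` is onto, hence bijective by dimension. Minimal triangular structures are
therefore the bialgebra isomorphisms `A^{*cop} → A` with the symmetry and the commutation rule.

The dual is generated by the characters and the `P_x` (`adjoin_eq_top`). They satisfy relations of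
the same shape as those of `A` (`prim_mul_char`, `prim_mul_prim`, `comul_prim`). No basis of `A` is
needed: an Euler operator counts degrees, and characteristic zero makes it invertible in positive
degree.

From `(φ, M)` to `f_T`: only `A` comes with a presentation, so the inverse map `A → A^{*cop}` is
built first. It hits all generators of the dual, hence is bijective by dimension. Symmetry and
commutation are checked on generators, where they reduce to the conditions that define `Φ` and
`S(k)`.

From `R` to `(φ, M)`: `f_R` carries grouplikes to grouplikes, that is `G^*` to `G`, and `P_x` to a
skew primitive element. The commutation rule forces this element into `V_{g⁻¹}` and forces `φ(f(g))
= g` (`exists_fREquiv_prim`, `charMap_F`). The symmetry yields the two adjointness conditions. -/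

namespace TriHopf

universe u v w

/-! ### Tensors as linear maps on the dual of the first factor. -/

section Contraction

variable {k : Type u} [Field k] {A : Type v} [AddCommGroup A] [Module k A]
  {B : Type w} [AddCommGroup B] [Module k B]

/-- Contraction of the first tensor factor with a functional. -/
def contract (p : Module.Dual k A) : A ⊗[k] B →ₗ[k] B :=
  (TensorProduct.lid k B).toLinearMap ∘ₗ p.rTensor B

@[simp] theorem contract_tmul (p : Module.Dual k A) (a : A) (b : B) :
    contract p (a ⊗ₜ[k] b) = p a • b := by
  simp [contract]

theorem contract_lTensor {C : Type*} [AddCommGroup C] [Module k C] (p : Module.Dual k A)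
    (φ : B →ₗ[k] C) (t : A ⊗[k] B) : contract p (φ.lTensor A t) = φ (contract p t) := by
  induction t with
  | zero => simp
  | add x y hx hy => simp only [map_add, hx, hy]
  | tmul a b => simp

theorem contract_rTensor {C : Type*} [AddCommGroup C] [Module k C] (p : Module.Dual k C)
    (φ : A →ₗ[k] C) (t : A ⊗[k] B) :
    contract p (φ.rTensor B t) = contract (p ∘ₗ φ) t := by
  induction t with
  | zero => simp
  | add x y hx hy => simp only [map_add, hx, hy]
  | tmul a b => simp

theorem comm_rTensor_apply {C : Type*} [AddCommGroup C] [Module k C] (φ : A →ₗ[k] C)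
    (t : A ⊗[k] B) : TensorProduct.comm k C B (φ.rTensor B t) =
      φ.lTensor B (TensorProduct.comm k A B t) := by
  induction t with
  | zero => simp
  | add x y hx hy => simp only [map_add, hx, hy]
  | tmul a b => simp

theorem apply_contract_comm (p q : Module.Dual k A) (t : A ⊗[k] A) :
    q (contract p (TensorProduct.comm k A A t)) = p (contract q t) := by
  induction t with
  | zero => simp
  | add x y hx hy => simp only [map_add, hx, hy]
  | tmul a b => simp [mul_comm]

variable [Module.Finite k A]

theorem sum_tmul_contract (t : A ⊗[k] B) :
    ∑ i, Module.finBasis k A i ⊗ₜ[k] contract ((Module.finBasis k A).coord i) t = t := by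
  induction t with
  | zero => simp
  | add x y hx hy =>
    simp only [map_add, TensorProduct.tmul_add, Finset.sum_add_distrib, hx, hy]
  | tmul a b =>
    simp only [contract_tmul, ← TensorProduct.smul_tmul, ← TensorProduct.sum_tmul,
      Module.Basis.coord_apply, Module.Basis.sum_repr]

theorem contract_ext {s t : A ⊗[k] B} (h : ∀ p : Module.Dual k A, contract p s = contract p t) :
    s = t := by
  rw [← sum_tmul_contract s, ← sum_tmul_contract t]
  simp only [h]

theorem exists_contract_eq (f : Module.Dual k A →ₗ[k] B) :
    ∃ t : A ⊗[k] B, ∀ p, contract p t = f p := by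
  refine ⟨∑ i, Module.finBasis k A i ⊗ₜ[k] f ((Module.finBasis k A).coord i), fun p => ?_⟩
  simp only [map_sum, contract_tmul, ← map_smul]
  rw [← map_sum, (Module.finBasis k A).sum_dual_apply_smul_coord]

/-- Over a field `W` is the image of a linear projection. Applied to either factor it fixes `t`,
because all slices of `t` along that factor lie in `W`. -/
theorem mem_range_map_of_contract_mem (W : Submodule k A) {t : A ⊗[k] A}
    (h₁ : ∀ p, contract p t ∈ W) (h₂ : ∀ p, contract p (TensorProduct.comm k A A t) ∈ W) :
    t ∈ LinearMap.range (TensorProduct.map W.subtype W.subtype) := by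
  obtain ⟨π, hπ⟩ := W.subtype.exists_leftInverse_of_injective W.ker_subtype
  have hπ' : ∀ w ∈ W, (π w : A) = w := fun w hw =>
    congrArg Subtype.val (LinearMap.congr_fun hπ ⟨w, hw⟩)
  have e₁ : ∀ t : A ⊗[k] A, (∀ p, contract p t ∈ W) →
      (W.subtype ∘ₗ π).lTensor A t = t := by
    intro t ht
    refine contract_ext fun p => ?_
    rw [contract_lTensor]
    exact hπ' _ (ht p)
  have e₂ : (W.subtype ∘ₗ π).rTensor A t = t := by
    apply (TensorProduct.comm k A A).injective
    rw [comm_rTensor_apply, e₁ _ h₂]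
  refine ⟨TensorProduct.map π π t, ?_⟩
  rw [← LinearMap.comp_apply, ← TensorProduct.map_comp, ← LinearMap.lTensor_comp_rTensor,
    LinearMap.comp_apply, e₂, e₁ t h₁]

end Contraction

/-! ### The axioms of a triangular structure in terms of `f_R`. -/

section Bialgebra

variable {k : Type u} [Field k] {A : Type v} [Ring A] [Bialgebra k A]

theorem fR_eq_contract (R : A ⊗[k] A) (p : DualCop k A) :
    fR k R p = contract (DualCop.toDual k A p) R := rfl

theorem ev_mul_eq (a : A) (p q : DualCop k A) :
    DualCop.ev a (p * q) = LinearMap.mul' k k (TensorProduct.map (DualCop.toDual k A p)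
      (DualCop.toDual k A q) (Coalgebra.comul (R := k) a)) := rfl

/-- Left translate of a functional: `z ↦ p (a z)`. -/
def transL (a : A) : DualCop k A →ₗ[k] DualCop k A :=
  (DualCop.toDual k A).symm.toLinearMap ∘ₗ Module.Dual.transpose (LinearMap.mulLeft k a) ∘ₗ
    (DualCop.toDual k A).toLinearMap

/-- Right translate of a functional: `z ↦ p (z a)`. -/
def transR (a : A) : DualCop k A →ₗ[k] DualCop k A :=
  (DualCop.toDual k A).symm.toLinearMap ∘ₗ Module.Dual.transpose (LinearMap.mulRight k a) ∘ₗ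
    (DualCop.toDual k A).toLinearMap

@[simp] theorem ev_transL (a z : A) (p : DualCop k A) :
    DualCop.ev z (transL a p) = DualCop.ev (a * z) p := rfl

@[simp] theorem ev_transR (a z : A) (p : DualCop k A) :
    DualCop.ev z (transR a p) = DualCop.ev (z * a) p := rfl

theorem contract_contract_comul (R : A ⊗[k] A) (p q : DualCop k A) :
    contract (DualCop.toDual k A q) (contract (DualCop.toDual k A p)
      (TensorProduct.assoc k A A A ((Coalgebra.comul (R := k) (A := A)).rTensor A R))) =
    fR k R (p * q) := by
  rw [fR_eq_contract]
  induction R with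
  | zero => simp
  | add x y hx hy => simp only [map_add, hx, hy]
  | tmul r s =>
    have : ∀ t : A ⊗[k] A, contract (DualCop.toDual k A q) (contract (DualCop.toDual k A p)
      (TensorProduct.assoc k A A A (t ⊗ₜ[k] s))) = LinearMap.mul' k k
        (TensorProduct.map (DualCop.toDual k A p) (DualCop.toDual k A q) t) • s := by
      intro t
      induction t with
      | zero => simp
      | add x y hx hy => simp only [map_add, TensorProduct.add_tmul, hx, hy, add_smul]
      | tmul a b => simp [mul_smul]
    simp only [LinearMap.rTensor_tmul, this, contract_tmul]
    rw [← ev_mul_eq]; rfl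

theorem contract_contract_mul (R R' : A ⊗[k] A) (p q : DualCop k A) :
    contract (DualCop.toDual k A q) (contract (DualCop.toDual k A p)
      (TensorProduct.leftComm k A A A (1 ⊗ₜ[k] R) * (1 ⊗ₜ[k] R'))) =
    fR k R p * fR k R' q := by
  simp only [fR_eq_contract]
  induction R with
  | zero => simp
  | add x y hx hy => simp only [map_add, TensorProduct.tmul_add, add_mul, hx, hy]
  | tmul r s =>
    induction R' with
    | zero => simp
    | add x y hx hy => simp only [map_add, TensorProduct.tmul_add, mul_add, hx, hy]
    | tmul r' s' => simp [smul_smul, mul_comm]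

/-- `f_R` as a linear map. -/
def fRLin (R : A ⊗[k] A) : DualCop k A →ₗ[k] A where
  toFun := fR k R
  map_add' p q := by
    simp only [fR_eq_contract, map_add, contract, LinearMap.rTensor_add]; simp
  map_smul' c p := by
    simp only [fR_eq_contract, map_smul, contract, LinearMap.rTensor_smul]; simp

@[simp] theorem fRLin_apply (R : A ⊗[k] A) (p : DualCop k A) : fRLin R p = fR k R p := rfl

/-- The first leg of the multiplier is moved onto the functional. Together with `contract_mul_tmul`
this turns `Δ^{cop}(a) R = R Δ(a)` into an identity between values of `f_R`. -/
theorem contract_tmul_mul (R : A ⊗[k] A) (a b : A) (p : DualCop k A) :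
    contract (DualCop.toDual k A p) ((a ⊗ₜ[k] b) * R) = b * fR k R (transL a p) := by
  rw [fR_eq_contract]
  induction R with
  | zero => simp
  | add x y hx hy => simp only [map_add, mul_add, hx, hy]
  | tmul r s =>
    simp only [Algebra.TensorProduct.tmul_mul_tmul, contract_tmul, mul_smul_comm]
    rfl

theorem contract_mul_tmul (R : A ⊗[k] A) (a b : A) (p : DualCop k A) :
    contract (DualCop.toDual k A p) (R * (a ⊗ₜ[k] b)) = fR k R (transR a p) * b := by
  rw [fR_eq_contract]
  induction R with
  | zero => simp
  | add x y hx hy => simp only [map_add, add_mul, hx, hy]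
  | tmul r s =>
    simp only [Algebra.TensorProduct.tmul_mul_tmul, contract_tmul, smul_mul_assoc]
    rfl

theorem IsTriangular.isUnit {R : A ⊗[k] A} (h : IsTriangular k R) : IsUnit R :=
  ⟨⟨R, TensorProduct.comm k A A R, h.mul_swap, h.swap_mul⟩, rfl⟩

theorem ev_ext {a b : A} (h : ∀ p : DualCop k A, DualCop.ev a p = DualCop.ev b p) : a = b :=
  Module.eval_apply_injective k (LinearMap.ext fun p => h ((DualCop.toDual k A).symm p))

theorem mul_counit_comul (a : A) : LinearMap.mul' k k (TensorProduct.map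
    (Coalgebra.counit (R := k)) (Coalgebra.counit (R := k)) (Coalgebra.comul (R := k) a)) =
      Coalgebra.counit (R := k) a := by
  have h : ∀ t : A ⊗[k] A, LinearMap.mul' k k (TensorProduct.map
      (Coalgebra.counit (R := k)) (Coalgebra.counit (R := k)) t) =
      Coalgebra.counit (R := k) (contract (Coalgebra.counit (R := k)) t) := by
    intro t
    induction t with
    | zero => simp
    | add x y hx hy => simp only [map_add, hx, hy]
    | tmul a b => simp
  rw [h, contract, LinearMap.comp_apply, Coalgebra.rTensor_counit_comul]
  simp

variable [Module.Finite k A]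

/-- Contracting the first two legs with `p` and `q` gives `f_R(p q)` on one side, the product of the
dual being convolution, and `f_R(p) f_R(q)` on the other. Such contractions separate tensors. -/
theorem comul_left_iff (R : A ⊗[k] A) :
    (TensorProduct.assoc k A A A ((Coalgebra.comul (R := k) (A := A)).rTensor A R) =
      TensorProduct.leftComm k A A A (1 ⊗ₜ[k] R) * (1 ⊗ₜ[k] R)) ↔
    ∀ p q, fR k R (p * q) = fR k R p * fR k R q := by
  constructor
  · intro h p q
    rw [← contract_contract_comul, h, contract_contract_mul]
  · intro h
    refine contract_ext fun p => contract_ext fun q => ?_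
    have h1 := contract_contract_comul R ((DualCop.toDual k A).symm p)
      ((DualCop.toDual k A).symm q)
    have h2 := contract_contract_mul R R ((DualCop.toDual k A).symm p)
      ((DualCop.toDual k A).symm q)
    simp only [LinearEquiv.apply_symm_apply] at h1 h2
    rw [h1, h2, h]

/-- For `R = r ⊗ s` and `R' = r' ⊗ s'` the left side is `p(r r') s' ⊗ s`. The order is reversed
between the two factors, which is what the opposite coproduct of the dual accounts for. Two separate
tensors are needed to argue by linearity in each. -/
theorem contract_mul (R R' : A ⊗[k] A) (p : DualCop k A) :
    contract (DualCop.toDual k A p) (TensorProduct.leftComm k A A A (1 ⊗ₜ[k] R) *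
      TensorProduct.assoc k A A A (R' ⊗ₜ[k] 1)) =
    TensorProduct.map (fRLin R') (fRLin R) (Coalgebra.comul (R := k) p) := by
  induction R with
  | zero =>
    have : fRLin (0 : A ⊗[k] A) = 0 := by ext; simp [fR_eq_contract]
    simp [this]
  | add x y hx hy =>
    have : fRLin (x + y) = fRLin x + fRLin y := by ext; simp [fR_eq_contract]
    simp only [map_add, TensorProduct.tmul_add, add_mul, hx, hy, this, TensorProduct.map_add_right,
      LinearMap.add_apply]
  | tmul r s =>
    induction R' with
    | zero =>
      have : fRLin (0 : A ⊗[k] A) = 0 := by ext; simp [fR_eq_contract]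
      simp [this]
    | add x y hx hy =>
      have : fRLin (x + y) = fRLin x + fRLin y := by ext; simp [fR_eq_contract]
      simp only [map_add, TensorProduct.add_tmul, mul_add, hx, hy, this,
        TensorProduct.map_add_left, LinearMap.add_apply]
    | tmul r' s' =>
      have h : ∀ t : DualCop k A ⊗[k] DualCop k A,
          TensorProduct.map (fRLin (r' ⊗ₜ[k] s')) (fRLin (r ⊗ₜ[k] s)) t =
            DualCop.ev₂ r' r t • (s' ⊗ₜ[k] s) := by
        intro t
        induction t with
        | zero => simp
        | add x y hx hy => simp only [map_add, hx, hy, add_smul]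
        | tmul a b =>
          simp [fR_eq_contract, TensorProduct.smul_tmul', TensorProduct.tmul_smul, smul_smul,
            DualCop.ev_linear_mul, mul_comm]
      rw [h, DualCop.ev₂_comul]
      simp [DualCop.ev_linear_mul]

theorem comul_right_iff (R : A ⊗[k] A) :
    ((Coalgebra.comul (R := k) (A := A)).lTensor A R =
      TensorProduct.leftComm k A A A (1 ⊗ₜ[k] R) * TensorProduct.assoc k A A A (R ⊗ₜ[k] 1)) ↔
    ∀ p, Coalgebra.comul (R := k) (fR k R p) =
      TensorProduct.map (fRLin R) (fRLin R) (Coalgebra.comul (R := k) p) := by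
  have h (p : DualCop k A) : contract (DualCop.toDual k A p)
      ((Coalgebra.comul (R := k) (A := A)).lTensor A R) = Coalgebra.comul (R := k) (fR k R p) := by
    rw [contract_lTensor]; rfl
  constructor
  · intro e p
    rw [← h, e, contract_mul]
  · intro e
    refine contract_ext fun p => ?_
    have h1 := h ((DualCop.toDual k A).symm p)
    have h2 := contract_mul R R ((DualCop.toDual k A).symm p)
    rw [LinearEquiv.apply_symm_apply] at h1 h2
    rw [h1, h2, e]

theorem fR_ext {R R' : A ⊗[k] A} (h : ∀ p, fR k R p = fR k R' p) : R = R' :=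
  contract_ext fun p => h ((DualCop.toDual k A).symm p)

theorem exists_fR_eq (f : DualCop k A →ₗ[k] A) : ∃ R : A ⊗[k] A, ∀ p, fR k R p = f p := by
  obtain ⟨R, hR⟩ := exists_contract_eq (f ∘ₗ (DualCop.toDual k A).symm.toLinearMap)
  refine ⟨R, fun p => ?_⟩
  rw [fR_eq_contract, hR, LinearMap.comp_apply, LinearEquiv.coe_coe, LinearEquiv.symm_apply_apply]

/-- The unit of the dual is `ε`, so `f_R(1) = (ε ⊗ I)(R)` is the image of a unit under an algebra
map. It is also idempotent, and an idempotent unit is `1`. -/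
theorem IsTriangular.fR_one {R : A ⊗[k] A} (h : IsTriangular k R) : fR k R 1 = 1 := by
  let φ : A ⊗[k] A →ₐ[k] A := (Algebra.TensorProduct.lid k A).toAlgHom.comp
    (Algebra.TensorProduct.map (Bialgebra.counitAlgHom k A) (AlgHom.id k A))
  have e : fR k R 1 = φ R := rfl
  have hu : IsUnit (fR k R 1) := e ▸ h.isUnit.map φ
  have := (comul_left_iff R).1 h.comul_left 1 1
  rw [mul_one] at this
  exact hu.mul_left_cancel (by rw [← this, mul_one])

/-- The left side is `p` evaluated at `(I ⊗ ε)(R)`. This element is a unit, and it is idempotent by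
the second coproduct axiom and `(ε ⊗ ε) Δ = ε`; so it is `1`. -/
theorem IsTriangular.counit_fR {R : A ⊗[k] A} (h : IsTriangular k R) (p : DualCop k A) :
    Coalgebra.counit (R := k) (fR k R p) = Coalgebra.counit (R := k) p := by
  let φ : A ⊗[k] A →ₐ[k] A := (Algebra.TensorProduct.rid k k A).toAlgHom.comp
    (Algebra.TensorProduct.map (AlgHom.id k A) (Bialgebra.counitAlgHom k A))
  have e : ∀ (R : A ⊗[k] A) (p : DualCop k A),
      Coalgebra.counit (R := k) (fR k R p) = DualCop.ev (φ R) p := by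
    intro R p
    rw [fR_eq_contract]
    induction R with
    | zero => simp [DualCop.ev_linear_mul]
    | add x y hx hy =>
      simp only [map_add, hx, hy, DualCop.ev_linear_mul]
    | tmul r s => simp [φ, DualCop.ev_linear_mul, mul_comm]
  have h₂ : ∀ p : DualCop k A, DualCop.ev (φ R) p = DualCop.ev (φ R * φ R) p := by
    intro p
    have h₃ : ∀ t : DualCop k A ⊗[k] DualCop k A, LinearMap.mul' k k (TensorProduct.map
        (Coalgebra.counit (R := k)) (Coalgebra.counit (R := k))
        (TensorProduct.map (fRLin R) (fRLin R) t)) = DualCop.ev₂ (φ R) (φ R) t := by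
      intro t
      induction t with
      | zero => simp
      | add x y hx hy => simp only [map_add, hx, hy]
      | tmul a b => simp [e]
    rw [← DualCop.ev₂_comul, ← e, ← mul_counit_comul, (comul_right_iff R).1 h.comul_right, h₃]
  have hu : IsUnit (φ R) := h.isUnit.map φ
  have h₃ : φ R * φ R = φ R * 1 := by
    rw [mul_one]
    exact ev_ext (k := k) fun p => (h₂ p).symm
  rw [e, hu.mul_left_cancel h₃, DualCop.counit_apply]

/-- The bialgebra map `f_R : A^{*cop} → A` of a triangular structure. -/
def IsTriangular.bialgHom {R : A ⊗[k] A} (h : IsTriangular k R) : DualCop k A →ₐc[k] A :=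
  BialgHom.ofAlgHom
    (AlgHom.ofLinearMap (fRLin R) h.fR_one ((comul_left_iff R).1 h.comul_left))
    (by
      apply AlgHom.ext
      intro p
      exact h.counit_fR p)
    (by
      apply AlgHom.ext
      intro p
      exact ((comul_right_iff R).1 h.comul_right p).symm)

end Bialgebra

/-! ### The inverse of `R`, and minimality as surjectivity of `f_R`. -/

section Hopf

variable {k : Type u} [Field k] {A : Type v} [Ring A] [HopfAlgebra k A]

/-- Apply `a ⊗ b ⊗ c ↦ a S(b) ⊗ c` to `(Δ ⊗ I)(R) = R₁₃ R₂₃`: the antipode axiom collapses the left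
side to `1 ⊗ f_R(1)`, and the right side becomes `R (S ⊗ I)(R)`. -/
theorem mul_antipode_rTensor_eq_one {R : A ⊗[k] A}
    (h : TensorProduct.assoc k A A A ((Coalgebra.comul (R := k) (A := A)).rTensor A R) =
      TensorProduct.leftComm k A A A (1 ⊗ₜ[k] R) * (1 ⊗ₜ[k] R))
    (h₁ : fR k R 1 = 1) : R * (HopfAlgebra.antipode k).rTensor A R = 1 := by
  let Ψ : A ⊗[k] (A ⊗[k] A) →ₗ[k] A ⊗[k] A :=
    (LinearMap.mul' k A ∘ₗ (HopfAlgebra.antipode k).lTensor A).rTensor A ∘ₗ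
      (TensorProduct.assoc k A A A).symm.toLinearMap
  have e₁ : ∀ R R' : A ⊗[k] A, Ψ (TensorProduct.leftComm k A A A (1 ⊗ₜ[k] R) * (1 ⊗ₜ[k] R')) =
      R * (HopfAlgebra.antipode k).rTensor A R' := by
    intro R R'
    induction R with
    | zero => simp
    | add x y hx hy => simp only [map_add, TensorProduct.tmul_add, add_mul, hx, hy]
    | tmul r s =>
      induction R' with
      | zero => simp
      | add x y hx hy => simp only [map_add, TensorProduct.tmul_add, mul_add, hx, hy]
      | tmul r' s' => simp [Ψ]
  have e₂ : ∀ R : A ⊗[k] A,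
      Ψ (TensorProduct.assoc k A A A ((Coalgebra.comul (R := k) (A := A)).rTensor A R)) =
        1 ⊗ₜ[k] fR k R 1 := by
    intro R
    rw [fR_eq_contract]
    induction R with
    | zero => simp
    | add x y hx hy => simp only [map_add, TensorProduct.tmul_add, hx, hy]
    | tmul r s =>
      simp only [Ψ, LinearMap.comp_apply, LinearEquiv.coe_coe, LinearMap.rTensor_tmul,
        LinearEquiv.symm_apply_apply, HopfAlgebra.mul_antipode_lTensor_comul_apply, contract_tmul]
      rw [Algebra.algebraMap_eq_smul_one, TensorProduct.smul_tmul]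
      rfl
  rw [← e₁, ← h, e₂, h₁, Algebra.TensorProduct.one_def]

/-- `R⁻¹ = (S ⊗ I)(R)`. -/
theorem IsTriangular.comm_eq {R : A ⊗[k] A} (h : IsTriangular k R) (h₁ : fR k R 1 = 1) :
    TensorProduct.comm k A A R = (HopfAlgebra.antipode k).rTensor A R := by
  have e := mul_antipode_rTensor_eq_one h.comul_left h₁
  calc TensorProduct.comm k A A R
      = TensorProduct.comm k A A R * (R * (HopfAlgebra.antipode k).rTensor A R) := by
        rw [e, mul_one]
    _ = (HopfAlgebra.antipode k).rTensor A R := by rw [← mul_assoc, h.swap_mul, one_mul]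

theorem swap_mul_of_mul_swap {R : A ⊗[k] A} (h : R * TensorProduct.comm k A A R = 1) :
    TensorProduct.comm k A A R * R = 1 := by
  have := congrArg (Algebra.TensorProduct.comm k A A) h
  rw [map_mul, map_one] at this
  change TensorProduct.comm k A A R * TensorProduct.comm k A A (TensorProduct.comm k A A R) = 1
    at this
  rwa [TensorProduct.comm_comm] at this

/-- Both `S ∘ f` and `f ∘ S` are inverses of `f` for convolution. -/
theorem map_antipode {C : Type*} [Ring C] [HopfAlgebra k C] (f : C →ₐc[k] A) (c : C) :
    HopfAlgebra.antipode k (f c) = f (HopfAlgebra.antipode k c) := by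
  let F : C →ₗ[k] A := (f : C →ₐ[k] A).toLinearMap
  have h₁ : WithConv.toConv F * WithConv.toConv (HopfAlgebra.antipode k ∘ₗ F) = 1 := by
    have := LinearMap.convMul_comp_coalgHom_distrib (WithConv.toConv LinearMap.id)
      (WithConv.toConv (HopfAlgebra.antipode k (A := A))) (f : C →ₗc[k] A)
    rw [LinearMap.id_mul_antipode] at this
    apply WithConv.ofConv_injective
    refine this.symm.trans ?_
    ext c
    simp [LinearMap.convOne_def]
  have h₂ : WithConv.toConv (F ∘ₗ HopfAlgebra.antipode k) * WithConv.toConv F = 1 := by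
    have := LinearMap.algHom_comp_convMul_distrib (f : C →ₐ[k] A)
      (WithConv.toConv (HopfAlgebra.antipode k (A := C))) (WithConv.toConv LinearMap.id)
    rw [LinearMap.antipode_mul_id] at this
    apply WithConv.ofConv_injective
    refine this.symm.trans ?_
    ext c
    simp only [LinearMap.convOne_def, LinearMap.comp_apply, WithConv.ofConv_toConv,
      Algebra.linearMap_apply, AlgHom.toLinearMap_apply, AlgHom.commutes]
  have := left_inv_eq_right_inv h₂ h₁
  exact (LinearMap.congr_fun (congrArg WithConv.ofConv this) c).symm

/-- The image of `f_R` is a sub Hopf algebra `B` with `R ∈ B ⊗ B`, so minimality applies to it. -/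
theorem IsMinimalTriangular.fR_surjective [Module.Finite k A] {R : A ⊗[k] A}
    (h : IsMinimalTriangular k R)
    (hS : ∀ p, ∃ q, fR k R q = HopfAlgebra.antipode k (fR k R p)) :
    Function.Surjective (fR k R) := by
  let f := h.toIsTriangular.bialgHom
  let B : Subalgebra k A := (f : DualCop k A →ₐ[k] A).range
  have hB : B = ⊤ := by
    refine h.minimal B ⟨?_, ?_⟩ ?_
    · rintro _ ⟨p, rfl⟩
      change Coalgebra.comul (R := k) (fR k R p) ∈ _
      rw [(comul_right_iff R).1 h.comul_right]
      have e : fRLin R = B.val.toLinearMap ∘ₗ (f : DualCop k A →ₐ[k] A).rangeRestrict.toLinearMap :=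
        rfl
      rw [e, TensorProduct.map_comp]
      exact ⟨_, rfl⟩
    · rintro _ ⟨p, rfl⟩
      exact hS p
    · refine mem_range_map_of_contract_mem B.toSubmodule (fun p => ?_) fun p => ?_
      · exact ⟨(DualCop.toDual k A).symm p, rfl⟩
      -- Slices of `R` along the second factor are values of `f_R` as well, since `R₂₁ = (S ⊗
      -- I)(R)`.
      · rw [h.toIsTriangular.comm_eq h.toIsTriangular.fR_one, contract_rTensor]
        exact ⟨(DualCop.toDual k A).symm (p ∘ₗ HopfAlgebra.antipode k), rfl⟩
  intro a
  have : a ∈ B := hB ▸ trivial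
  exact this

theorem minimal_of_fR_surjective {R : A ⊗[k] A} (h : Function.Surjective (fR k R))
    (B : Subalgebra k A)
    (hR : R ∈ LinearMap.range (TensorProduct.map B.val.toLinearMap B.val.toLinearMap)) :
    B = ⊤ := by
  rw [eq_top_iff]
  rintro a -
  obtain ⟨p, rfl⟩ := h a
  obtain ⟨t, rfl⟩ := hR
  rw [fR_eq_contract]
  clear h
  induction t with
  | zero => simp
  | add x y hx hy => rw [map_add, map_add]; exact add_mem hx hy
  | tmul r s => simpa using B.smul_mem s.2 _

end Hopf

namespace Datum

section

variable {k : Type u} [Field k] {G : Type w} [CommGroup G] (D : Datum k G)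

/-! ### The dual is generated by the characters and the functionals `P_x` -/

/-- The character `α ∈ G^*` as an element of `H(D)^{*cop}`. -/
def char (α : G →* kˣ) : DualCop k D.H := DualCop.of (D.charHom α).toLinearMap

/-- The functional `P_x` as an element of `H(D)^{*cop}`. -/
def prim (g : D.IF) (x : Module.Dual k (D.V g)) : DualCop k D.H := DualCop.of (D.P g x)

theorem ev_char (α : G →* kˣ) (z : D.H) : DualCop.ev z (D.char α) = D.charHom α z := rfl

theorem ev_prim (g : D.IF) (x : Module.Dual k (D.V g)) (z : D.H) :
    DualCop.ev z (D.prim g x) = D.P g x z := rfl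

theorem rep_apply_one_zero (g : D.IF) (x : Module.Dual k (D.V g)) (z : D.H) :
    D.rep g x z 1 0 = 0 := by
  induction z using D.induction with
  | hc c => simp [Matrix.algebraMap_matrix_apply]
  | hG a => simp [rep_ofG]
  | hV h y => simp [rep_ofV]
  | hadd y z hy hz => simp [hy, hz]
  | hmul y z hy hz => simp [Matrix.mul_apply, hy, hz]

theorem rep_apply_zero_zero (g : D.IF) (x : Module.Dual k (D.V g)) (z : D.H) :
    D.rep g x z 0 0 = Coalgebra.counit (R := k) z := by
  induction z using D.induction with
  | hc c => simp [Matrix.algebraMap_matrix_apply]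
  | hG a => simp [rep_ofG]
  | hV h y => simp [rep_ofV]
  | hadd y z hy hz => simp [hy, hz]
  | hmul y z hy hz => simp [Matrix.mul_apply, hy, hz, rep_apply_one_zero]

theorem rep_apply_one_one (g : D.IF) (x : Module.Dual k (D.V g)) (z : D.H) :
    D.rep g x z 1 1 = D.charHom (D.F (g : G)⁻¹) z := by
  induction z using D.induction with
  | hc c => simp [Matrix.algebraMap_matrix_apply]
  | hG a => simp only [rep_ofG, charHom_ofG, F_inv_left]; simp
  | hV h y => simp [rep_ofV]
  | hadd y z hy hz => simp [hy, hz]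
  | hmul y z hy hz => simp [Matrix.mul_apply, hy, hz, rep_apply_one_zero]

/-- The defining representation is upper triangular with diagonal entries `ε` and `f(g⁻¹)`; this is
the off-diagonal entry of a product. Dually it is the coproduct of `P_x`. -/
theorem P_mul (g : D.IF) (x : Module.Dual k (D.V g)) (y z : D.H) :
    D.P g x (y * z) = Coalgebra.counit (R := k) y * D.P g x z +
      D.P g x y * D.charHom (D.F (g : G)⁻¹) z := by
  rw [← rep_apply_one_one D g x, ← rep_apply_zero_zero D g x]
  simp [P, Matrix.mul_apply]

@[simp] theorem P_ofG (g : D.IF) (x : Module.Dual k (D.V g)) (a : G) : D.P g x (D.ofG a) = 0 := by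
  simp [P, rep_ofG]

@[simp] theorem P_one (g : D.IF) (x : Module.Dual k (D.V g)) : D.P g x 1 = 0 := by
  rw [← map_one D.ofG, P_ofG]

theorem P_ofV (g : D.IF) (x : Module.Dual k (D.V g)) (h : D.IF) (y : D.V h) :
    D.P g x (D.ofV h y) = D.pairing g x h y := by
  simp [P, rep_ofV]

/-- Elements of degree at most `n`. -/
def deg : ℕ → Submodule k D.H
  | 0 => D.spanG
  | n + 1 => deg n ⊔ Submodule.span k {z | ∃ y ∈ deg n, ∃ (g : D.IF) (x : D.V g), z = y * D.ofV g x}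

theorem deg_le_succ (n : ℕ) : D.deg n ≤ D.deg (n + 1) := le_sup_left

theorem mul_ofV_mem_deg {n : ℕ} {z : D.H} (hz : z ∈ D.deg n) (g : D.IF) (x : D.V g) :
    z * D.ofV g x ∈ D.deg (n + 1) :=
  Submodule.mem_sup_right (Submodule.subset_span ⟨z, hz, g, x, rfl⟩)

theorem deg_succ_le {n : ℕ} {W : Submodule k D.H} (h₁ : D.deg n ≤ W)
    (h₂ : ∀ z ∈ D.deg n, ∀ (g : D.IF) (x : D.V g), z * D.ofV g x ∈ W) : D.deg (n + 1) ≤ W := by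
  refine sup_le h₁ (Submodule.span_le.2 ?_)
  rintro _ ⟨y, hy, g, x, rfl⟩
  exact h₂ y hy g x

theorem deg_zero_le {W : Submodule k D.H} (h : ∀ a, D.ofG a ∈ W) : D.deg 0 ≤ W := by
  refine Submodule.span_le.2 ?_
  rintro _ ⟨a, rfl⟩
  exact h a

theorem mul_ofG_mem_deg {n : ℕ} {z : D.H} (hz : z ∈ D.deg n) (a : G) :
    z * D.ofG a ∈ D.deg n := by
  induction n generalizing z with
  | zero =>
    refine (D.deg_zero_le (W := (D.deg 0).comap (LinearMap.mulRight k (D.ofG a))) ?_) hz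
    intro b
    change D.ofG b * D.ofG a ∈ D.deg 0
    rw [← map_mul]
    exact D.ofG_mem_spanG _
  | succ n ih =>
    refine (D.deg_succ_le (W := (D.deg (n + 1)).comap (LinearMap.mulRight k (D.ofG a)))
      (fun z hz => D.deg_le_succ n (ih hz)) ?_) hz
    intro z hz g x
    rw [Submodule.mem_comap, LinearMap.mulRight_apply]
    rw [mul_assoc, ofV_mul_ofG, mul_smul_comm, ← mul_assoc]
    exact Submodule.smul_mem _ _ (D.mul_ofV_mem_deg (ih hz) g x)

theorem deg_mono : Monotone D.deg := monotone_nat_of_le_succ D.deg_le_succ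

theorem exists_mem_deg (z : D.H) : ∃ n, z ∈ D.deg n := by
  suffices h : ∀ z : D.H, ∀ n, ∀ y ∈ D.deg n, ∃ m, y * z ∈ D.deg m by
    obtain ⟨m, hm⟩ := h z 0 1 D.one_mem_spanG
    exact ⟨m, by simpa using hm⟩
  refine D.induction ?_ ?_ ?_ ?_ ?_
  · intro c n y hy
    exact ⟨n, by rw [← Algebra.commutes, ← Algebra.smul_def]; exact Submodule.smul_mem _ _ hy⟩
  · intro a n y hy
    exact ⟨n, D.mul_ofG_mem_deg hy a⟩
  · intro g x n y hy
    exact ⟨n + 1, D.mul_ofV_mem_deg hy g x⟩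
  · intro z w hz hw n y hy
    obtain ⟨m, hm⟩ := hz n y hy
    obtain ⟨l, hl⟩ := hw n y hy
    rw [mul_add]
    exact ⟨max m l, add_mem (D.deg_mono (le_max_left _ _) hm) (D.deg_mono (le_max_right _ _) hl)⟩
  · intro z w hz hw n y hy
    obtain ⟨m, hm⟩ := hz n y hy
    rw [← mul_assoc]
    exact hw m _ hm

/-- The skew derivation `z ↦ ∑ z₁ ⟨P_x, z₂⟩`. -/
def skewDer (g : D.IF) (x : Module.Dual k (D.V g)) : D.H →ₗ[k] D.H :=
  contract (D.P g x) ∘ₗ (TensorProduct.comm k D.H D.H).toLinearMap ∘ₗ Coalgebra.comul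

@[simp] theorem skewDer_ofG (g : D.IF) (x : Module.Dual k (D.V g)) (a : G) :
    D.skewDer g x (D.ofG a) = 0 := by
  simp [skewDer]

/-- A twisted Leibniz rule. It comes from `Δ(y) = y ⊗ 1 + h ⊗ y`; in `P_x(z₂ y)` only `ε(z₂) P_x(y)`
survives, because characters vanish on `V_h`. -/
theorem skewDer_mul_ofV (g : D.IF) (x : Module.Dual k (D.V g)) (z : D.H) (h : D.IF) (y : D.V h) :
    D.skewDer g x (z * D.ofV h y) =
      D.pairing g x h y • (z * D.ofG h) + D.skewDer g x z * D.ofV h y := by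
  have h₁ : ∀ t : D.H ⊗[k] D.H, contract (D.P g x) (TensorProduct.comm k D.H D.H
      (t * (D.ofV h y ⊗ₜ 1))) =
      contract (D.P g x) (TensorProduct.comm k D.H D.H t) * D.ofV h y := by
    intro t
    induction t with
    | zero => simp
    | add s t hs ht => simp only [add_mul, map_add, hs, ht]
    | tmul a b => simp
  have h₂ : ∀ t : D.H ⊗[k] D.H, contract (D.P g x) (TensorProduct.comm k D.H D.H
      (t * (D.ofG h ⊗ₜ D.ofV h y))) = D.pairing g x h y •
      (contract (Coalgebra.counit (R := k)) (TensorProduct.comm k D.H D.H t) * D.ofG h) := by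
    intro t
    induction t with
    | zero => simp
    | add s t hs ht => simp only [add_mul, map_add, hs, ht, smul_add]
    | tmul a b => simp [P_mul, P_ofV, smul_smul, mul_comm]
  have h₃ : contract (Coalgebra.counit (R := k)) (TensorProduct.comm k D.H D.H
      (Coalgebra.comul (R := k) z)) = z := by
    have h : ∀ t : D.H ⊗[k] D.H, contract (Coalgebra.counit (R := k))
        (TensorProduct.comm k D.H D.H t) =
        TensorProduct.rid k D.H ((Coalgebra.counit (R := k)).lTensor D.H t) := by
      intro t
      induction t with
      | zero => simp
      | add s t hs ht => simp only [map_add, hs, ht]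
      | tmul a b => simp
    rw [h, Coalgebra.lTensor_counit_comul, TensorProduct.rid_tmul, one_smul]
  simp only [skewDer, LinearMap.comp_apply, Bialgebra.comul_mul, comul_ofV, mul_add, map_add,
    LinearEquiv.coe_coe, h₁, h₂, h₃]
  rw [add_comm]

theorem skewDer_mem_deg (g : D.IF) (x : Module.Dual k (D.V g)) {n : ℕ} {z : D.H}
    (hz : z ∈ D.deg (n + 1)) : D.skewDer g x z ∈ D.deg n := by
  have h0 : D.deg 0 ≤ LinearMap.ker (D.skewDer g x) := D.deg_zero_le fun a => by simp
  induction n generalizing z with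
  | zero =>
    refine (D.deg_succ_le (W := (D.deg 0).comap (D.skewDer g x)) ?_ ?_) hz
    · intro z hz
      simp [show D.skewDer g x z = 0 from h0 hz]
    · intro z hz h y
      rw [Submodule.mem_comap, skewDer_mul_ofV, show D.skewDer g x z = 0 from h0 hz, zero_mul,
        add_zero]
      exact Submodule.smul_mem _ _ (D.mul_ofG_mem_deg hz _)
  | succ n ih =>
    refine (D.deg_succ_le (W := (D.deg (n + 1)).comap (D.skewDer g x)) ?_ ?_) hz
    · intro z hz
      exact D.deg_le_succ n (ih hz)
    · intro z hz h y
      rw [Submodule.mem_comap, skewDer_mul_ofV]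
      exact add_mem (Submodule.smul_mem _ _ (D.mul_ofG_mem_deg hz _))
        (D.mul_ofV_mem_deg (ih hz) _ _)

/-- The two factors of `F` cancel, so `g⁻¹ x` commutes with every `V_h`. This is why the Euler
operator is built from the elements `gᵢ⁻¹ vᵢ`. -/
theorem ofV_mul_ofG_inv_mul_ofV (g h : D.IF) (x : D.V g) (y : D.V h) :
    D.ofV h y * (D.ofG (g : G)⁻¹ * D.ofV g x) = D.ofG (g : G)⁻¹ * D.ofV g x * D.ofV h y := by
  rw [ofV_mul_ofG_mul, ofV_mul_ofV, mul_smul_comm, smul_smul, F_inv_left, F_mul_F, one_smul,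
    mul_assoc]

theorem eq_one_of_forall_char (D : Datum k G) {a : G} (h : ∀ α : G →* kˣ, α a = 1) : a = 1 := by
  apply D.nondegenerate.injective
  ext b
  rw [D.skew a b, h, map_one, MonoidHom.one_apply, inv_one]

/-- Elements of `G` act on `G^*` by evaluation. They are distinct characters of `G^*` because the
characters `f(b)` already separate points, and distinct characters are linearly independent. -/
theorem eq_zero_of_mem_spanG {z : D.H} (hz : z ∈ D.deg 0)
    (h : ∀ α : G →* kˣ, D.charHom α z = 0) : z = 0 := by
  let e : G → ((G →* kˣ) →* k) := fun a =>
    (Units.coeHom k).comp (MonoidHom.eval a)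
  have he : Function.Injective e := by
    intro a b hab
    rw [← div_eq_one]
    refine D.eq_one_of_forall_char fun α => ?_
    have : (α a : k) = α b := DFunLike.congr_fun hab α
    rw [map_div, Units.ext this, div_self']
  have hli : LinearIndependent k fun a => (e a : (G →* kˣ) → k) :=
    (linearIndependent_monoidHom (G →* kˣ) k).comp e he
  obtain ⟨c, rfl⟩ := (Finsupp.mem_span_range_iff_exists_finsupp).1 (show z ∈ Submodule.span k _ from hz)
  have hc : c = 0 := by
    refine (linearIndependent_iff.1 hli) c ?_
    ext α
    have := h α
    simp only [Finsupp.sum, map_sum, map_smul, charHom_ofG] at this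
    simpa [Finsupp.linearCombination_apply, Finsupp.sum, e] using this
  simp [hc]

/-- The Euler operator `z ↦ ∑ᵢ ∂ᵢ(z) gᵢ⁻¹ vᵢ`, over a basis `(vᵢ)` of the sum of the `V_g`. -/
def euler : D.H →ₗ[k] D.H :=
  ∑ᶠ i : Σ g : D.IF, Fin (D.n g), LinearMap.mulRight k (D.ofG (i.1 : G)⁻¹ *
    D.ofV i.1 (Pi.single i.2 1)) ∘ₗ D.skewDer i.1 (LinearMap.proj i.2)

theorem euler_apply [Fintype (Σ g : D.IF, Fin (D.n g))] (z : D.H) :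
    D.euler z = ∑ i : Σ g : D.IF, Fin (D.n g), D.skewDer i.1 (LinearMap.proj i.2) z *
      (D.ofG (i.1 : G)⁻¹ * D.ofV i.1 (Pi.single i.2 1)) := by
  simp [euler, finsum_eq_sum_of_fintype, mul_assoc]

variable [Finite G]

@[simp] theorem euler_ofG (a : G) : D.euler (D.ofG a) = 0 := by
  have : Fintype (Σ g : D.IF, Fin (D.n g)) := Fintype.ofFinite _
  simp [euler_apply]

/-- Each right factor from some `V_h` adds one to the eigenvalue. In the Leibniz rule the first term
sums to `z y` by expanding `y` in the basis, and the second is `euler z * y` because `gᵢ⁻¹ vᵢ`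
commutes with `y`. -/
theorem euler_mul_ofV (z : D.H) (h : D.IF) (y : D.V h) :
    D.euler (z * D.ofV h y) = D.euler z * D.ofV h y + z * D.ofV h y := by
  classical
  have : Fintype D.IF := Fintype.ofFinite _
  have h₁ : ∑ i : Σ g : D.IF, Fin (D.n g), D.pairing i.1 (LinearMap.proj i.2) h y •
      (z * D.ofG h * (D.ofG (i.1 : G)⁻¹ * D.ofV i.1 (Pi.single i.2 1))) = z * D.ofV h y := by
    rw [Fintype.sum_sigma, Finset.sum_eq_single h]
    · simp only [pairing_self, LinearMap.proj_apply, mul_assoc z, ofG_mul_ofG_mul, mul_inv_cancel,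
        map_one, one_mul, ← mul_smul_comm, ← Finset.mul_sum]
      have hy : ∑ j, y j • (Pi.single j 1 : D.V h) = y := by
        simpa using (Pi.basisFun k (Fin (D.n h))).sum_repr y
      congr 1
      rw [← congrArg (D.ofV h) hy, map_sum]
      simp only [map_smul]
    · intro g _ hg
      simp [D.pairing_ne g h hg]
    · simp
  simp only [euler_apply, skewDer_mul_ofV, add_mul, Finset.sum_add_distrib, smul_mul_assoc, h₁]
  rw [add_comm, Finset.sum_mul]
  congr 1
  refine Finset.sum_congr rfl fun i _ => ?_
  rw [mul_assoc, ofV_mul_ofG_inv_mul_ofV, mul_assoc, mul_assoc, mul_assoc]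

theorem euler_sub_mem_deg {n : ℕ} {z : D.H} (hz : z ∈ D.deg (n + 1)) :
    D.euler z - ((n + 1 : ℕ) : k) • z ∈ D.deg n := by
  have h0 : D.deg 0 ≤ LinearMap.ker D.euler := D.deg_zero_le fun a => by simp
  induction n generalizing z with
  | zero =>
    refine (D.deg_succ_le
      (W := (D.deg 0).comap (D.euler - ((0 + 1 : ℕ) : k) • LinearMap.id)) ?_ ?_) hz
    · intro z hz
      simpa [show D.euler z = 0 from h0 hz] using hz
    · intro z hz h y
      have : D.euler z = 0 := h0 hz
      simp [euler_mul_ofV, this]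
  | succ n ih =>
    refine (D.deg_succ_le
      (W := (D.deg (n + 1)).comap (D.euler - ((n + 1 + 1 : ℕ) : k) • LinearMap.id)) ?_ ?_) hz
    · intro z hz
      -- For `z` already in the smaller filtration step the eigenvalue is off by one; the extra `z`
      -- is harmless since it lies in `deg (n + 1)`.
      have e : (D.euler - ((n + 1 + 1 : ℕ) : k) • LinearMap.id : D.H →ₗ[k] D.H) z =
          (D.euler z - ((n + 1 : ℕ) : k) • z) - z := by
        simp only [LinearMap.sub_apply, LinearMap.smul_apply, LinearMap.id_apply]
        push_cast
        module
      rw [Submodule.mem_comap, e]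
      exact sub_mem (D.deg_le_succ n (ih hz)) hz
    · intro z hz h y
      have e : (D.euler - ((n + 1 + 1 : ℕ) : k) • LinearMap.id : D.H →ₗ[k] D.H) (z * D.ofV h y) =
          (D.euler z - ((n + 1 : ℕ) : k) • z) * D.ofV h y := by
        simp only [LinearMap.sub_apply, LinearMap.smul_apply, LinearMap.id_apply, euler_mul_ofV,
          sub_mul, smul_mul_assoc]
        push_cast
        module
      rw [Submodule.mem_comap, e]
      exact D.mul_ofV_mem_deg (ih hz) h y

variable [CharZero k]

/-- Induction on the degree. For `z ∈ W` of degree at most `n + 1` the derivatives lie in `W` and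
have degree at most `n`, so they vanish and the Euler operator kills `z`. Then `(n + 1) z` has
degree at most `n`, and `n + 1` is invertible. -/
theorem eq_zero_of_forall_mem {W : Submodule k D.H}
    (hW : ∀ z ∈ W, ∀ α : G →* kˣ, D.charHom α z = 0)
    (hder : ∀ z ∈ W, ∀ g x, D.skewDer g x z ∈ W) : W = ⊥ := by
  suffices h : ∀ n, ∀ z ∈ D.deg n, z ∈ W → z = 0 by
    rw [Submodule.eq_bot_iff]
    intro z hz
    obtain ⟨n, hn⟩ := D.exists_mem_deg z
    exact h n z hn hz
  intro n
  induction n with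
  | zero => exact fun z hz hzW => D.eq_zero_of_mem_spanG hz (hW z hzW)
  | succ n ih =>
    intro z hz hzW
    refine ih z ?_ hzW
    have : Fintype (Σ g : D.IF, Fin (D.n g)) := Fintype.ofFinite _
    have e : D.euler z = 0 := by
      rw [euler_apply]
      refine Finset.sum_eq_zero fun i _ => ?_
      rw [ih _ (D.skewDer_mem_deg _ _ hz) (hder z hzW _ _), zero_mul]
    have h := D.euler_sub_mem_deg hz
    rw [e, zero_sub, neg_mem_iff] at h
    exact (Submodule.smul_mem_iff _ (Nat.cast_ne_zero.2 n.succ_ne_zero)).1 h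

/-- The algebra `H(D)^{*cop}` is generated by the characters and the functionals `P_x`. -/
theorem adjoin_eq_top : Algebra.adjoin k
    (Set.range D.char ∪ Set.range fun y : Σ g : D.IF, Module.Dual k (D.V g) => D.prim y.1 y.2) =
      ⊤ := by
  set C := Algebra.adjoin k
    (Set.range D.char ∪ Set.range fun y : Σ g : D.IF, Module.Dual k (D.V g) => D.prim y.1 y.2)
  let Φ : Submodule k (Module.Dual k D.H) :=
    C.toSubmodule.map (DualCop.toDual k D.H).toLinearMap
  -- The common kernel of the generated subalgebra is stable under the skew derivations, because `⟨p
  -- P_x, z⟩ = ⟨p, ∂ₓ z⟩`. In finite dimension a space of functionals with zero common kernel is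
  -- everything.
  have hΦ : Φ.dualCoannihilator = ⊥ := by
    refine D.eq_zero_of_forall_mem ?_ ?_
    · intro z hz α
      rw [Submodule.mem_dualCoannihilator] at hz
      exact hz _ ⟨D.char α, Algebra.subset_adjoin (Or.inl ⟨α, rfl⟩), rfl⟩
    · intro z hz g x
      rw [Submodule.mem_dualCoannihilator] at hz ⊢
      rintro _ ⟨p, hp, rfl⟩
      have h := hz _ ⟨p * D.prim g x, C.mul_mem hp
        (Algebra.subset_adjoin (Or.inr ⟨⟨g, x⟩, rfl⟩)), rfl⟩
      have e : ∀ t : D.H ⊗[k] D.H, DualCop.toDual k D.H p (contract (D.P g x)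
          (TensorProduct.comm k D.H D.H t)) = LinearMap.mul' k k
          (TensorProduct.map (DualCop.toDual k D.H p) (D.P g x) t) := by
        intro t
        induction t with
        | zero => simp
        | add s t hs ht => simp only [map_add, hs, ht]
        | tmul a b => simp [mul_comm]
      exact (e _).trans h
  have hΦ' : Φ = ⊤ := by
    rw [← Subspace.dualCoannihilator_dualAnnihilator_eq (W := Φ), hΦ,
      Submodule.dualAnnihilator_bot]
  rw [← Algebra.toSubmodule_eq_top]
  apply Submodule.map_injective_of_injective (DualCop.toDual k D.H).injective
  exact hΦ'.trans (by rw [Submodule.map_top, LinearEquiv.range])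

end

section

variable {k : Type u} [Field k] {G : Type w} [CommGroup G] (D : Datum k G)

/-! ### The Hopf algebra structure of the dual on generators -/

theorem char_one : D.char 1 = 1 := rfl

theorem ev_ofG_mul (p q : DualCop k D.H) (a : G) :
    DualCop.ev (D.ofG a) (p * q) = DualCop.ev (D.ofG a) p * DualCop.ev (D.ofG a) q := by
  rw [ev_mul_eq, comul_ofG]
  simp [DualCop.ev_linear_mul]

theorem ev_ofV_mul (p q : DualCop k D.H) (g : D.IF) (v : D.V g) :
    DualCop.ev (D.ofV g v) (p * q) = DualCop.ev (D.ofV g v) p * DualCop.ev 1 q +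
      DualCop.ev (D.ofG g) p * DualCop.ev (D.ofV g v) q := by
  rw [ev_mul_eq, comul_ofV]
  simp [DualCop.ev_linear_mul]

theorem ev_mul_char_mul (α : G →* kˣ) (y z : D.H) :
    DualCop.ev (y * z) (D.char α) = DualCop.ev y (D.char α) * DualCop.ev z (D.char α) := by
  simp [ev_char]

/-- Translation by `a` acts on products of functionals through `Δ(a)`. Two terms cover all
generators of `H(D)`; for grouplikes the second term is taken to be zero. -/
theorem transL_mul_of_comul {a : D.H} {b c d e : D.H}
    (h : Coalgebra.comul (R := k) a = b ⊗ₜ c + d ⊗ₜ e) (p q : DualCop k D.H) :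
    transL a (p * q) = transL b p * transL c q + transL d p * transL e q := by
  refine DualCop.ext_ev fun z => ?_
  rw [ev_transL, map_add, ev_mul_eq, ev_mul_eq, ev_mul_eq, Bialgebra.comul_mul, h]
  generalize Coalgebra.comul (R := k) z = t
  induction t with
  | zero => simp
  | add s t hs ht => simp only [mul_add, map_add, hs, ht]; abel
  | tmul s t =>
    simp only [add_mul, Algebra.TensorProduct.tmul_mul_tmul, map_add, TensorProduct.map_tmul]
    rfl

theorem transR_mul_of_comul {a : D.H} {b c d e : D.H}
    (h : Coalgebra.comul (R := k) a = b ⊗ₜ c + d ⊗ₜ e) (p q : DualCop k D.H) :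
    transR a (p * q) = transR b p * transR c q + transR d p * transR e q := by
  refine DualCop.ext_ev fun z => ?_
  rw [ev_transR, map_add, ev_mul_eq, ev_mul_eq, ev_mul_eq, Bialgebra.comul_mul, h]
  generalize Coalgebra.comul (R := k) z = t
  induction t with
  | zero => simp
  | add s t hs ht => simp only [add_mul, map_add, hs, ht]; abel
  | tmul s t =>
    simp only [mul_add, Algebra.TensorProduct.tmul_mul_tmul, map_add, TensorProduct.map_tmul]
    rfl

theorem transL_ofG_mul (a : G) (p q : DualCop k D.H) :
    transL (D.ofG a) (p * q) = transL (D.ofG a) p * transL (D.ofG a) q := by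
  rw [D.transL_mul_of_comul (b := D.ofG a) (c := D.ofG a) (d := 0) (e := 0) (by simp)]
  have : transL (0 : D.H) p = 0 := DualCop.ext_ev fun z => by
    rw [ev_transL, zero_mul]
    simp [DualCop.ev_linear_mul]
  rw [this, zero_mul, add_zero]

theorem transR_ofG_mul (a : G) (p q : DualCop k D.H) :
    transR (D.ofG a) (p * q) = transR (D.ofG a) p * transR (D.ofG a) q := by
  rw [D.transR_mul_of_comul (b := D.ofG a) (c := D.ofG a) (d := 0) (e := 0) (by simp)]
  have : transR (0 : D.H) p = 0 := DualCop.ext_ev fun z => by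
    rw [ev_transR, mul_zero]
    simp [DualCop.ev_linear_mul]
  rw [this, zero_mul, add_zero]

theorem ofV_eq_zero (g : D.IF) (hg : D.n g = 0) (v : D.V g) : D.ofV g v = 0 := by
  have : Subsingleton (D.V g) := by
    have : IsEmpty (Fin (D.n g)) := by rw [hg]; infer_instance
    infer_instance
  rw [Subsingleton.elim v 0, map_zero]

theorem prim_injective (g : D.IF) : Function.Injective (D.prim g) := by
  intro x y hxy
  refine LinearMap.ext fun v => ?_
  have := congrArg (DualCop.ev (D.ofV g v)) hxy
  simpa [ev_prim, P_ofV, pairing_self] using this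

theorem char_inv_inv (α : G →* kˣ) : α⁻¹⁻¹ = α := by ext; simp

variable [CharZero k] [Finite G]

theorem comul_char (α : G →* kˣ) :
    Coalgebra.comul (R := k) (D.char α) = D.char α ⊗ₜ[k] D.char α := by
  refine DualCop.ext_ev₂ fun a b => ?_
  rw [DualCop.ev₂_comul, DualCop.ev₂_tmul, ev_mul_char_mul, mul_comm]

@[simp] theorem counit_char (α : G →* kˣ) : Coalgebra.counit (R := k) (D.char α) = 1 := by
  rw [DualCop.counit_apply, ev_char, map_one]

theorem comul_prim (g : D.IF) (x : Module.Dual k (D.V g)) :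
    Coalgebra.comul (R := k) (D.prim g x) =
      D.prim g x ⊗ₜ[k] 1 + D.char (D.F (g : G)⁻¹) ⊗ₜ[k] D.prim g x := by
  refine DualCop.ext_ev₂ fun a b => ?_
  rw [DualCop.ev₂_comul, map_add, DualCop.ev₂_tmul, DualCop.ev₂_tmul, ev_prim, ev_prim, ev_prim,
    P_mul, ev_char, DualCop.ev_one]
  ring

@[simp] theorem counit_prim (g : D.IF) (x : Module.Dual k (D.V g)) :
    Coalgebra.counit (R := k) (D.prim g x) = 0 := by
  rw [DualCop.counit_apply, ev_prim, P_one]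

/-- Two skew primitive elements of the dual are equal if they agree on generators. -/
theorem eq_of_comul_eq {p q c d : DualCop k D.H}
    (hp : Coalgebra.comul (R := k) p = p ⊗ₜ[k] c + d ⊗ₜ[k] p)
    (hq : Coalgebra.comul (R := k) q = q ⊗ₜ[k] c + d ⊗ₜ[k] q)
    (hG : ∀ a, DualCop.ev (D.ofG a) p = DualCop.ev (D.ofG a) q)
    (hV : ∀ g v, DualCop.ev (D.ofV g v) p = DualCop.ev (D.ofV g v) q) : p = q := by
  refine DualCop.ext_ev fun z => ?_
  induction z using D.induction with
  | hc c =>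
    rw [Algebra.algebraMap_eq_smul_one, ← map_one D.ofG]
    simp only [DualCop.ev_linear_mul, map_smul] at hG ⊢
    rw [hG]
  | hG a => exact hG a
  | hV g v => exact hV g v
  | hadd y z hy hz => simp only [DualCop.ev_linear_mul, map_add] at hy hz ⊢; rw [hy, hz]
  | hmul y z hy hz =>
    rw [← DualCop.ev₂_comul, ← DualCop.ev₂_comul, hp, hq]
    simp [hy, hz]

/-- A product of grouplikes is multiplicative on `H(D)`, so it suffices to compare on generators. -/
theorem char_mul_char (α β : G →* kˣ) : D.char α * D.char β = D.char (α * β) := by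
  refine DualCop.ext_ev fun z => ?_
  have h : ∀ α : G →* kˣ, ∀ y z : D.H, DualCop.ev (y * z) (D.char α) =
    DualCop.ev y (D.char α) * DualCop.ev z (D.char α) := fun α y z => D.ev_mul_char_mul α y z
  have h' : ∀ y z : D.H, DualCop.ev (y * z) (D.char α * D.char β) =
      DualCop.ev y (D.char α * D.char β) * DualCop.ev z (D.char α * D.char β) := by
    intro y z
    rw [← DualCop.ev₂_comul, Bialgebra.comul_mul, comul_char, comul_char,
      Algebra.TensorProduct.tmul_mul_tmul, DualCop.ev₂_tmul, mul_comm]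
  induction z using D.induction with
  | hc c =>
    rw [Algebra.algebraMap_eq_smul_one, ← map_one D.ofG]
    simp only [DualCop.ev_linear_mul, map_smul]
    simp only [← DualCop.ev_linear_mul, ev_ofG_mul, ev_char]
    simp
  | hG a => simp [ev_ofG_mul, ev_char]
  | hV g v => simp [ev_ofV_mul, ev_char]
  | hadd y z hy hz => simp only [DualCop.ev_linear_mul, map_add] at hy hz ⊢; rw [hy, hz]
  | hmul y z hy hz => rw [h, h', hy, hz]

/-- Both sides are skew primitive with the same grouplike factors and agree on generators. The
scalar compensates for the `α(g)` that evaluation of the right side on `V_g` produces. -/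
theorem prim_mul_char (g : D.IF) (x : Module.Dual k (D.V g)) (α : G →* kˣ) :
    D.prim g x * D.char α = ((α g)⁻¹ : kˣ) • (D.char α * D.prim g x) := by
  refine D.eq_of_comul_eq (c := D.char α) (d := D.char (D.F (g : G)⁻¹ * α)) ?_ ?_ ?_ ?_
  · rw [Bialgebra.comul_mul, comul_prim, comul_char]
    simp only [add_mul, Algebra.TensorProduct.tmul_mul_tmul, one_mul, char_mul_char]
  · rw [Units.smul_def, map_smul, Bialgebra.comul_mul, comul_prim, comul_char]
    simp only [mul_add, Algebra.TensorProduct.tmul_mul_tmul, mul_one, char_mul_char, smul_add,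
      mul_comm α, TensorProduct.smul_tmul', TensorProduct.tmul_smul]
  · intro a
    simp [Units.smul_def, ev_ofG_mul, ev_prim]
  · intro h v
    simp only [Units.smul_def, map_smul, ev_ofV_mul, ev_prim, ev_char, P_ofG, P_one, map_one,
      charHom_ofV, charHom_ofG, P_ofV, smul_eq_mul]
    by_cases e : g = h
    · subst e
      rw [Units.val_inv_eq_inv_val]
      field_simp
      ring
    · simp [D.pairing_ne g h e]

/-- With this scalar the mixed terms in the coproduct of the difference cancel. The difference is
then skew primitive and vanishes on generators, hence is zero. -/
theorem prim_mul_prim (g h : D.IF) (x : Module.Dual k (D.V g)) (y : Module.Dual k (D.V h)) :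
    D.prim g x * D.prim h y = (D.F h g : k) • (D.prim h y * D.prim g x) := by
  rw [← sub_eq_zero]
  refine D.eq_of_comul_eq (c := 1) (d := D.char (D.F (g : G)⁻¹ * D.F (h : G)⁻¹)) ?_ (by simp) ?_ ?_
  · have e₁ : ((D.F (h : G)⁻¹ g)⁻¹ : kˣ) = D.F h g := by simp
    have e₂ : (D.F h g : k) * (((D.F (g : G)⁻¹ h)⁻¹ : kˣ) : k) = 1 := by
      rw [map_inv, MonoidHom.inv_apply, inv_inv, F_mul_F]
    rw [map_sub, map_smul, Bialgebra.comul_mul, Bialgebra.comul_mul, comul_prim, comul_prim]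
    simp only [mul_add, add_mul, Algebra.TensorProduct.tmul_mul_tmul, mul_one, one_mul,
      char_mul_char, prim_mul_char, e₁]
    simp only [Units.smul_def, smul_add, TensorProduct.smul_tmul', smul_smul, e₂, one_smul,
      TensorProduct.sub_tmul, TensorProduct.tmul_sub, TensorProduct.tmul_smul,
      mul_comm (D.F (h : G)⁻¹) (D.F (g : G)⁻¹)]
    abel
  · intro a
    simp [ev_ofG_mul, ev_prim]
  · intro h v
    simp [ev_ofV_mul, ev_prim]

theorem prim_add (g : D.IF) (x y : Module.Dual k (D.V g)) :
    D.prim g (x + y) = D.prim g x + D.prim g y := by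
  refine D.eq_of_comul_eq (D.comul_prim _ _) (c := 1) (d := D.char (D.F (g : G)⁻¹)) ?_ ?_ ?_
  · rw [map_add, comul_prim, comul_prim, TensorProduct.add_tmul, TensorProduct.tmul_add]
    abel
  · intro a; simp [ev_prim]
  · intro h v
    by_cases e : g = h
    · subst e; simp [ev_prim, P_ofV, pairing_self]
    · simp [ev_prim, P_ofV, D.pairing_ne g h e]

theorem prim_smul (g : D.IF) (c : k) (x : Module.Dual k (D.V g)) :
    D.prim g (c • x) = c • D.prim g x := by
  refine D.eq_of_comul_eq (D.comul_prim _ _) (c := 1) (d := D.char (D.F (g : G)⁻¹)) ?_ ?_ ?_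
  · rw [map_smul, comul_prim, smul_add, TensorProduct.smul_tmul', TensorProduct.tmul_smul]
  · intro a; simp [ev_prim]
  · intro h v
    by_cases e : g = h
    · subst e; simp [ev_prim, P_ofV, pairing_self]
    · simp [ev_prim, P_ofV, D.pairing_ne g h e]

/-- `x ↦ P_x` as a linear map `V_g^* → H(D)^{*cop}`. -/
def primLin (g : D.IF) : Module.Dual k (D.V g) →ₗ[k] DualCop k D.H where
  toFun := D.prim g
  map_add' := D.prim_add g
  map_smul' := D.prim_smul g

@[simp] theorem primLin_apply (g : D.IF) (x : Module.Dual k (D.V g)) :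
    D.primLin g x = D.prim g x := rfl

theorem prim_eq_zero (g : D.IF) (hg : D.n g = 0) (x : Module.Dual k (D.V g)) : D.prim g x = 0 := by
  have : Subsingleton (D.V g) := by
    have : IsEmpty (Fin (D.n g)) := by rw [hg]; infer_instance
    infer_instance
  have hx : x = 0 := LinearMap.ext fun v => by rw [Subsingleton.elim v 0]; simp
  rw [hx, ← primLin_apply, map_zero]

/-- Induction principle for `H(D)^{*cop}`. -/
theorem dual_induction {motive : DualCop k D.H → Prop} (char : ∀ α, motive (D.char α))
    (prim : ∀ g x, D.n g ≠ 0 → motive (D.prim g x))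
    (add : ∀ p q, motive p → motive q → motive (p + q))
    (smul : ∀ (c : k) p, motive p → motive (c • p))
    (mul : ∀ p q, motive p → motive q → motive (p * q)) (p : DualCop k D.H) : motive p := by
  have hp : p ∈ Algebra.adjoin k (Set.range D.char ∪
      Set.range fun y : Σ g : D.IF, Module.Dual k (D.V g) => D.prim y.1 y.2) := by
    rw [adjoin_eq_top]; trivial
  induction hp using Algebra.adjoin_induction with
  | mem p hp =>
    rcases hp with ⟨α, rfl⟩ | ⟨⟨g, x⟩, rfl⟩
    · exact char α
    · by_cases hg : D.n g = 0
      · change motive (D.prim g x)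
        rw [D.prim_eq_zero g hg, ← zero_smul k (D.char 1)]
        exact smul _ _ (char 1)
      · exact prim g x hg
  | algebraMap c =>
    rw [Algebra.algebraMap_eq_smul_one, ← char_one]
    exact smul _ _ (char 1)
  | add p q _ _ hp hq => exact add p q hp hq
  | mul p q _ _ hp hq => exact mul p q hp hq

theorem dual_algHom_ext {B : Type*} [Ring B] [Algebra k B] {f f' : DualCop k D.H →ₐ[k] B}
    (char : ∀ α, f (D.char α) = f' (D.char α))
    (prim : ∀ g x, D.n g ≠ 0 → f (D.prim g x) = f' (D.prim g x)) : f = f' := by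
  apply AlgHom.ext
  refine D.dual_induction char prim ?_ ?_ ?_
  · intro p q hp hq; simp [hp, hq]
  · intro c p hp; simp [hp]
  · intro p q hp hq; simp [hp, hq]

/-! ### The antipodes -/

theorem antipode_char (α : G →* kˣ) : HopfAlgebra.antipode k (D.char α) = D.char α⁻¹ := by
  have h := HopfAlgebra.mul_antipode_rTensor_comul_apply (R := k) (D.char α)
  rw [comul_char, LinearMap.rTensor_tmul, LinearMap.mul'_apply, counit_char, map_one] at h
  calc _ = HopfAlgebra.antipode k (D.char α) * (D.char α * D.char α⁻¹) := by
        rw [char_mul_char, show α * α⁻¹ = 1 by ext; simp, char_one, mul_one]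
    _ = D.char α⁻¹ := by rw [← mul_assoc, h, one_mul]

theorem antipode_prim (g : D.IF) (x : Module.Dual k (D.V g)) :
    HopfAlgebra.antipode k (D.prim g x) = -(D.char (D.F g) * D.prim g x) := by
  have h := HopfAlgebra.mul_antipode_rTensor_comul_apply (R := k) (D.prim g x)
  rw [comul_prim, map_add, LinearMap.rTensor_tmul, LinearMap.rTensor_tmul, map_add,
    LinearMap.mul'_apply, LinearMap.mul'_apply, counit_prim, map_zero, antipode_char, mul_one,
    map_inv, char_inv_inv] at h
  exact eq_neg_of_add_eq_zero_left h

end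

section

variable {k : Type u} [Field k] {G : Type w} [CommGroup G] (D : Datum k G)

/-! ### The isomorphism of a pair `(φ, M)` -/

/-- The inverse in `I_F`. -/
def inv (g : D.IF) : D.IF := (D.exists_inv_IF g).choose

theorem mul_inv (g : D.IF) : (g : G) * D.inv g = 1 := (D.exists_inv_IF g).choose_spec

theorem inv_mul (g : D.IF) : (D.inv g : G) * g = 1 := by rw [mul_comm, mul_inv]

theorem coe_inv (g : D.IF) : (D.inv g : G) = (g : G)⁻¹ := eq_inv_of_mul_eq_one_right (D.mul_inv g)

theorem eq_inv {g h : D.IF} (e : (g : G) * h = 1) : g = D.inv h :=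
  Subtype.ext (by rw [coe_inv]; exact eq_inv_of_mul_eq_one_left e)

variable {D}

theorem SK.n_eq (M : D.SK) {g h : D.IF} (hg : D.n g ≠ 0) (e : (g : G) * h = 1) :
    D.n g = D.n h := by
  have := (M.M g h hg e).finrank_eq
  rwa [Subspace.dual_finrank_eq, Module.finrank_fin_fun, Module.finrank_fin_fun] at this

theorem SK.n_inv_ne (M : D.SK) {g : D.IF} (hg : D.n g ≠ 0) : D.n (D.inv g) ≠ 0 :=
  M.n_eq hg (D.mul_inv g) ▸ hg

theorem Phi.apply_inv (Φ : D.Phi) (α : G →* kˣ) : Φ.φ α⁻¹ = (Φ.φ α)⁻¹ :=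
  map_inv Φ.φ α

/-- Take `β = f(g)` in the adjointness of `φ`. This matches the commutation of `P_x` with characters
to that of `V_g` with `G`. -/
theorem Phi.F_apply (Φ : D.Phi) (α : G →* kˣ) {g : D.IF} (hg : D.n g ≠ 0) :
    D.F (Φ.φ α) g = α g := by
  have h := Φ.adjoint α (D.F g)
  rw [Φ.fix g hg] at h
  rw [h, Φ.apply_inv, map_inv, D.skew]

theorem F_inv_right (g h : G) : (D.F g h⁻¹ : k) = D.F h g := by
  rw [map_inv, ← D.skew]

theorem transL_ofG_char (a : G) (α : G →* kˣ) :
    transL (D.ofG a) (D.char α) = (α a : k) • D.char α := by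
  refine DualCop.ext_ev fun z => ?_
  simp [ev_char]

theorem transR_ofG_char (a : G) (α : G →* kˣ) :
    transR (D.ofG a) (D.char α) = (α a : k) • D.char α := by
  refine DualCop.ext_ev fun z => ?_
  simp [ev_char, mul_comm]

theorem transL_ofG_prim (a : G) (g : D.IF) (x : Module.Dual k (D.V g)) :
    transL (D.ofG a) (D.prim g x) = D.prim g x := by
  refine DualCop.ext_ev fun z => ?_
  simp [ev_prim, P_mul]

theorem transR_ofG_prim (a : G) (g : D.IF) (x : Module.Dual k (D.V g)) :
    transR (D.ofG a) (D.prim g x) = (D.F a g : k) • D.prim g x := by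
  refine DualCop.ext_ev fun z => ?_
  simp only [ev_transR, ev_prim, P_mul, P_ofG, charHom_ofG, F_inv_left, map_smul, smul_eq_mul]
  ring

theorem transL_ofV_char (h : D.IF) (v : D.V h) (α : G →* kˣ) :
    transL (D.ofV h v) (D.char α) = 0 := by
  refine DualCop.ext_ev fun z => ?_
  simp [ev_char]

theorem transR_ofV_char (h : D.IF) (v : D.V h) (α : G →* kˣ) :
    transR (D.ofV h v) (D.char α) = 0 := by
  refine DualCop.ext_ev fun z => ?_
  simp [ev_char]

theorem transL_ofV_prim (h : D.IF) (v : D.V h) (g : D.IF) (x : Module.Dual k (D.V g)) :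
    transL (D.ofV h v) (D.prim g x) = D.pairing g x h v • D.char (D.F (g : G)⁻¹) := by
  refine DualCop.ext_ev fun z => ?_
  simp only [ev_transL, ev_prim, P_mul, counit_ofV, P_ofV, map_smul, smul_eq_mul, ev_char]
  ring

theorem transR_ofV_prim (h : D.IF) (v : D.V h) (g : D.IF) (x : Module.Dual k (D.V g)) :
    transR (D.ofV h v) (D.prim g x) = D.pairing g x h v • 1 := by
  refine DualCop.ext_ev fun z => ?_
  simp only [ev_transR, ev_prim, P_mul, charHom_ofV, P_ofV, map_smul, smul_eq_mul, DualCop.ev_one]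
  ring

variable (D) in
theorem finrank_dualCop : Module.finrank k (DualCop k D.H) = Module.finrank k D.H := by
  rw [(DualCop.toDual k D.H).finrank_eq, Subspace.dual_finrank_eq]

variable [CharZero k] [Finite G]

open scoped Classical in
/-- The map `V_h → H(D)^{*cop}` that sends `M_g(x)` to `P_x` for `g = h⁻¹`. -/
def invPrim (M : D.SK) (h : D.IF) : D.V h →ₗ[k] DualCop k D.H :=
  if hg : D.n (D.inv h) ≠ 0 then
    D.primLin (D.inv h) ∘ₗ (M.M (D.inv h) h hg (D.inv_mul h)).symm.toLinearMap
  else 0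

theorem invPrim_apply (M : D.SK) {g h : D.IF} (hg : D.n g ≠ 0) (e : (g : G) * h = 1)
    (x : Module.Dual k (D.V g)) : invPrim M h (M.M g h hg e x) = D.prim g x := by
  obtain rfl := D.eq_inv e
  simp [invPrim, hg]

/-- The default value `0` of `invPrim` occurs only when `V_h` itself is zero, because `M` forces
`n_g = n_{g⁻¹}`. Relations then need checking on the `P_x` only. -/
theorem exists_invPrim_eq (M : D.SK) (h : D.IF) (v : D.V h) :
    D.n h ≠ 0 ∧ (∃ x, invPrim M h v = D.prim (D.inv h) x) ∨ D.n h = 0 ∧ invPrim M h v = 0 := by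
  by_cases hh : D.n h = 0
  · right
    refine ⟨hh, ?_⟩
    by_cases hg : D.n (D.inv h) ≠ 0
    · exact absurd ((M.n_eq hg (D.inv_mul h)).trans hh) hg
    · simp [invPrim, hg]
  · left
    refine ⟨hh, (M.M (D.inv h) h (M.n_inv_ne hh) (D.inv_mul h)).symm v, ?_⟩
    simp [invPrim, M.n_inv_ne hh]

/-- The algebra map `H(D) → H(D)^{*cop}` inverse to `f_T`. -/
def invAlgHom (T : D.Phi × D.SK) : D.H →ₐ[k] DualCop k D.H :=
  D.lift
    { toFun := fun a => D.char (T.1.φ.symm a)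
      map_one' := by rw [map_one, char_one]
      map_mul' := fun a b => by rw [map_mul, char_mul_char] }
    (invPrim T.2)
    (by
      intro g h v w
      obtain ⟨_, x, hx⟩ | ⟨_, hx⟩ := exists_invPrim_eq T.2 g v
      · obtain ⟨_, y, hy⟩ | ⟨_, hy⟩ := exists_invPrim_eq T.2 h w
        · rw [hx, hy, prim_mul_prim, coe_inv, coe_inv, F_inv_left, F_inv_left]
        · simp [hy]
      · simp [hx])
    (by
      intro g v a
      obtain ⟨hg, x, hx⟩ | ⟨_, hx⟩ := exists_invPrim_eq T.2 g v
      · have h := T.1.F_apply (T.1.φ.symm a) hg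
        rw [MulEquiv.apply_symm_apply] at h
        simp only [hx, MonoidHom.coe_mk, OneHom.coe_mk, prim_mul_char, coe_inv, map_inv, inv_inv, h,
          Units.smul_def]
      · simp [hx])

@[simp] theorem invAlgHom_ofG (T : D.Phi × D.SK) (a : G) :
    invAlgHom T (D.ofG a) = D.char (T.1.φ.symm a) := by
  simp [invAlgHom]

@[simp] theorem invAlgHom_ofV (T : D.Phi × D.SK) (g : D.IF) (v : D.V g) :
    invAlgHom T (D.ofV g v) = invPrim T.2 g v := by
  simp [invAlgHom]

/-- The bialgebra map `H(D) → H(D)^{*cop}` inverse to `f_T`. -/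
def invBialgHom (T : D.Phi × D.SK) : D.H →ₐc[k] DualCop k D.H :=
  BialgHom.ofAlgHom (invAlgHom T)
    (by
      apply D.algHom_ext
      · intro a; simp
      · intro g v
        obtain ⟨_, x, hx⟩ | ⟨_, hx⟩ := exists_invPrim_eq T.2 g v
        · simp [hx]
        · simp [hx])
    (by
      apply D.algHom_ext
      · intro a; simp [comul_char]
      · intro g v
        obtain ⟨hg, x, hx⟩ | ⟨_, hx⟩ := exists_invPrim_eq T.2 g v
        -- The condition `φ(f(g)) = g` is what makes the map compatible with coproducts on `V_g`.
        · have h : T.1.φ.symm (g : G) = D.F g := by rw [MulEquiv.symm_apply_eq, T.1.fix g hg]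
          simp [hx, comul_prim, coe_inv, h, -map_inv]
        · simp [hx])

theorem invBialgHom_apply (T : D.Phi × D.SK) (z : D.H) : invBialgHom T z = invAlgHom T z := rfl

instance : Module.Finite k (DualCop k D.H) :=
  Module.Finite.equiv (DualCop.toDual k D.H).symm

theorem invBialgHom_surjective (T : D.Phi × D.SK) : Function.Surjective (invBialgHom T) := by
  refine D.dual_induction ?_ ?_ ?_ ?_ ?_
  · intro α
    exact ⟨D.ofG (T.1.φ α), by simp [invBialgHom_apply]⟩
  · intro g x hg
    exact ⟨D.ofV (D.inv g) (T.2.M g (D.inv g) hg (D.mul_inv g) x), by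
      rw [invBialgHom_apply, invAlgHom_ofV, invPrim_apply]⟩
  · rintro _ _ ⟨y, rfl⟩ ⟨z, rfl⟩
    exact ⟨y + z, map_add _ _ _⟩
  · rintro c _ ⟨y, rfl⟩
    exact ⟨c • y, map_smul _ _ _⟩
  · rintro _ _ ⟨y, rfl⟩ ⟨z, rfl⟩
    exact ⟨y * z, map_mul _ _ _⟩

theorem invBialgHom_bijective (T : D.Phi × D.SK) : Function.Bijective (invBialgHom T) := by
  refine ⟨?_, invBialgHom_surjective T⟩
  exact (LinearMap.injective_iff_surjective_of_finrank_eq_finrank D.finrank_dualCop.symm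
    (f := (invAlgHom T).toLinearMap)).2 (invBialgHom_surjective T)

/-- The isomorphism `f_T : H(D)^{*cop} → H(D)`. -/
def fT (T : D.Phi × D.SK) : DualCop k D.H ≃ₐc[k] D.H :=
  (BialgEquiv.ofBijective (invBialgHom T) (invBialgHom_bijective T)).symm

theorem fT_invAlgHom (T : D.Phi × D.SK) (z : D.H) : fT T (invAlgHom T z) = z :=
  (BialgEquiv.ofBijective (invBialgHom T) (invBialgHom_bijective T)).symm_apply_apply z

@[simp] theorem fT_char (T : D.Phi × D.SK) (α : G →* kˣ) :
    fT T (D.char α) = D.ofG (T.1.φ α) := by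
  rw [← fT_invAlgHom T (D.ofG _), invAlgHom_ofG, MulEquiv.symm_apply_apply]

theorem fT_prim (T : D.Phi × D.SK) {g h : D.IF} (hg : D.n g ≠ 0) (e : (g : G) * h = 1)
    (x : Module.Dual k (D.V g)) : fT T (D.prim g x) = D.ofV h (T.2.M g h hg e x) := by
  rw [← fT_invAlgHom T (D.ofV _ _), invAlgHom_ofV, invPrim_apply]

theorem sends_fT (T : D.Phi × D.SK) : D.Sends T (fT T) :=
  ⟨fT_char T, fun _ _ hg e x => fT_prim T hg e x⟩

theorem Sends.eq_fT {T : D.Phi × D.SK} {f : DualCop k D.H ≃ₐc[k] D.H} (hf : D.Sends T f) :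
    f = fT T := by
  have : ((f : DualCop k D.H ≃ₐ[k] D.H) : DualCop k D.H →ₐ[k] D.H) =
      ((fT T : DualCop k D.H ≃ₐ[k] D.H) : DualCop k D.H →ₐ[k] D.H) := by
    apply D.dual_algHom_ext
    · intro α
      exact (hf.1 α).trans (fT_char T α).symm
    · intro g x hg
      exact (hf.2 g (D.inv g) hg (D.mul_inv g) x).trans (fT_prim T hg (D.mul_inv g) x).symm
  exact BialgEquiv.ext fun p => AlgHom.congr_fun this p

/-! ### The triangular structure of a pair `(φ, M)` -/

/-- This is `Δ^{cop}(a) R = R Δ(a)` for `a ∈ G`, contracted with `p`. On `P_x` it holds because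
`F(a, g) F(a, g⁻¹) = 1`. -/
theorem fT_trans_ofG (T : D.Phi × D.SK) (a : G) (p : DualCop k D.H) :
    D.ofG a * fT T (transL (D.ofG a) p) = fT T (transR (D.ofG a) p) * D.ofG a := by
  induction p using D.dual_induction with
  | char α =>
    rw [transL_ofG_char, transR_ofG_char]
    simp only [map_smul, fT_char, mul_smul_comm, smul_mul_assoc, ← map_mul, mul_comm a]
  | prim g x hg =>
    rw [transL_ofG_prim, transR_ofG_prim, map_smul, fT_prim T hg (D.mul_inv g), smul_mul_assoc,
      ofV_mul_ofG, smul_smul, coe_inv, F_inv_right, F_mul_F, one_smul]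
  | add p q hp hq => simp only [map_add, mul_add, add_mul, hp, hq]
  | smul c p hp => simp only [map_smul, mul_smul_comm, smul_mul_assoc, hp]
  | mul p q hp hq =>
    rw [transL_ofG_mul, transR_ofG_mul, map_mul, map_mul, ← mul_assoc, hp, mul_assoc, hq, mul_assoc]

/-- The same axiom for `v ∈ V_h`, contracted with `p`. For `p = P_x` the pairing terms match because
`h φ(f(h))⁻¹ = 1`, and the others by the relation between `V_h` and `V_{g⁻¹}`. -/
theorem fT_trans_ofV (T : D.Phi × D.SK) (h : D.IF) (v : D.V h) (p : DualCop k D.H) :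
    D.ofV h v * fT T p + D.ofG h * fT T (transL (D.ofV h v) p) =
      fT T (transR (D.ofV h v) p) + fT T (transR (D.ofG h) p) * D.ofV h v := by
  -- The conditions on `φ` say nothing about `h` when `n_h = 0`, but then `v = 0`.
  by_cases hh : D.n h = 0
  · have e₁ : transL (0 : D.H) p = 0 := DualCop.ext_ev fun z => by
      rw [ev_transL, zero_mul]
      simp [DualCop.ev_linear_mul]
    have e₂ : transR (0 : D.H) p = 0 := DualCop.ext_ev fun z => by
      rw [ev_transR, mul_zero]
      simp [DualCop.ev_linear_mul]
    simp [D.ofV_eq_zero h hh, e₁, e₂]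
  induction p using D.dual_induction with
  | char α =>
    rw [transL_ofV_char, transR_ofV_char, transR_ofG_char]
    simp only [map_zero, map_smul, fT_char, mul_zero, add_zero, zero_add, ofV_mul_ofG,
      T.1.F_apply α hh, smul_mul_assoc]
  | prim g x hg =>
    rw [transL_ofV_prim, transR_ofV_prim, transR_ofG_prim, map_smul, map_smul, map_smul, map_one,
      fT_char, fT_prim T hg (D.mul_inv g), smul_mul_assoc, ofV_mul_ofV, coe_inv, F_inv_left,
      mul_smul_comm, add_comm]
    congr 1
    by_cases e : g = h
    · subst e
      rw [map_inv, map_inv, T.1.fix g hg, ← map_mul, mul_inv_cancel, map_one]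
    · rw [D.pairing_ne g h e, zero_smul, zero_smul]
  | add p q hp hq =>
    simp only [map_add, mul_add, add_mul]
    have := congrArg₂ (· + ·) hp hq
    convert this using 1 <;> abel
  | smul c p hp => simp only [map_smul, mul_smul_comm, smul_mul_assoc, ← smul_add, hp]
  | mul p q hp hq =>
    have e₁ : ∀ p : DualCop k D.H, transL (1 : D.H) p = p := fun p =>
      DualCop.ext_ev fun z => by rw [ev_transL, one_mul]
    have e₂ : ∀ p : DualCop k D.H, transR (1 : D.H) p = p := fun p =>
      DualCop.ext_ev fun z => by rw [ev_transR, mul_one]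
    rw [D.transL_mul_of_comul (D.comul_ofV h v), D.transR_mul_of_comul (D.comul_ofV h v),
      transR_ofG_mul, e₁, e₂]
    simp only [map_add, map_mul, mul_add]
    have hG := fT_trans_ofG T (h : G) p
    calc _ = (D.ofV h v * fT T p + D.ofG h * fT T (transL (D.ofV h v) p)) * fT T q +
          D.ofG h * fT T (transL (D.ofG h) p) * fT T (transL (D.ofV h v) q) := by noncomm_ring
      _ = fT T (transR (D.ofV h v) p) * fT T q + fT T (transR (D.ofG h) p) *
          (D.ofV h v * fT T q + D.ofG h * fT T (transL (D.ofV h v) q)) := by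
        rw [hp, hG]; noncomm_ring
      _ = _ := by rw [hq]; noncomm_ring

end

/-! ### The symmetry of `f_T`, and `R_T` as a minimal triangular structure. -/

section

variable {k : Type u} [Field k] {G : Type w} [CommGroup G] (D : Datum k G)

theorem unopLin_mul {A : Type*} [Ring A] [Algebra k A] (S : A →ₐ[k] Aᵐᵒᵖ) (a b : A) :
    unopLin S (a * b) = unopLin S b * unopLin S a := by
  simp [unopLin_apply]

theorem unopLin_algebraMap {A : Type*} [Ring A] [Algebra k A] (S : A →ₐ[k] Aᵐᵒᵖ) (c : k) :
    unopLin S (algebraMap k A c) = algebraMap k A c := by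
  simp [unopLin_apply]

theorem antipode_skewAntipode (z : D.H) :
    HopfAlgebra.antipode k (unopLin D.skewAntipodeHom z) = z := by
  change unopLin D.antipodeHom _ = z
  induction z using D.induction with
  | hc c => simp only [unopLin_algebraMap]
  | hG a => simp
  | hV g v =>
    simp only [unopLin_skewAntipodeHom_ofV, map_neg, unopLin_mul, unopLin_antipodeHom_ofV,
      unopLin_antipodeHom_ofG, inv_inv, mul_neg, neg_neg, ofG_mul_ofG_mul, mul_inv_cancel, map_one,
      one_mul]
  | hadd y z hy hz => simp only [map_add, hy, hz]
  | hmul y z hy hz => simp only [unopLin_mul, hy, hz]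

theorem skewAntipode_antipode (z : D.H) :
    unopLin D.skewAntipodeHom (HopfAlgebra.antipode k z) = z := by
  change unopLin D.skewAntipodeHom (unopLin D.antipodeHom z) = z
  induction z using D.induction with
  | hc c => simp only [unopLin_algebraMap]
  | hG a => simp
  | hV g v =>
    simp only [unopLin_skewAntipodeHom_ofV, map_neg, unopLin_mul, unopLin_antipodeHom_ofV,
      unopLin_skewAntipodeHom_ofG, inv_inv, neg_mul, neg_neg, mul_assoc, ← map_mul,
      inv_mul_cancel, map_one, mul_one]
  | hadd y z hy hz => simp only [map_add, hy, hz]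
  | hmul y z hy hz => simp only [unopLin_mul, hy, hz]

theorem ofG_injective : Function.Injective D.ofG := by
  intro a b hab
  rw [← div_eq_one]
  refine D.eq_one_of_forall_char fun α => ?_
  have := congrArg (D.charHom α) hab
  rw [charHom_ofG, charHom_ofG] at this
  rw [map_div, Units.ext this, div_self']

theorem ofV_injective (g : D.IF) : Function.Injective (D.ofV g) := by
  intro v w hvw
  rw [← sub_eq_zero, ← Module.forall_dual_apply_eq_zero_iff k]
  intro x
  have := congrArg (D.P g x) hvw
  rw [P_ofV, P_ofV, pairing_self, pairing_self] at this
  rw [map_sub, this, sub_self]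

variable [CharZero k] [Finite G]

theorem ev_antipode (z : D.H) (p : DualCop k D.H) :
    DualCop.ev z (HopfAlgebra.antipode k p) = DualCop.ev (unopLin D.skewAntipodeHom z) p := rfl

variable {D}

theorem ev_bialgHom_mul (f : DualCop k D.H →ₐc[k] D.H) (p p' q : DualCop k D.H) :
    DualCop.ev (f q) (p * p') = LinearMap.mul' k k (TensorProduct.map
      (DualCop.toDual k D.H p ∘ₗ (f : DualCop k D.H →ₗc[k] D.H).toLinearMap)
      (DualCop.toDual k D.H p' ∘ₗ (f : DualCop k D.H →ₗc[k] D.H).toLinearMap)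
      (Coalgebra.comul (R := k) q)) := by
  rw [ev_mul_eq, ← CoalgHomClass.map_comp_comul_apply f, TensorProduct.map_comp]
  rfl

/-- Both sides are multiplicative in `q`; on characters the identity is the adjointness of `φ`, and
on `P_x` both sides vanish. -/
theorem ev_fT_char (T : D.Phi × D.SK) (α : G →* kˣ) (q : DualCop k D.H) :
    DualCop.ev (fT T q) (D.char α) = DualCop.ev (D.ofG (T.1.φ α)⁻¹) q := by
  induction q using D.dual_induction with
  | char β =>
    rw [fT_char, ev_char, ev_char, charHom_ofG, charHom_ofG, T.1.adjoint, T.1.apply_inv]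
  | prim g x hg =>
    rw [fT_prim T hg (D.mul_inv g), ev_char, ev_prim, charHom_ofV, P_ofG]
  | add p q hp hq =>
    simp only [DualCop.ev_linear_mul, map_add] at hp hq ⊢
    rw [hp, hq]
  | smul c p hp =>
    simp only [DualCop.ev_linear_mul, map_smul] at hp ⊢
    rw [hp]
  | mul p q hp hq => rw [map_mul, ev_mul_char_mul, hp, hq, ev_ofG_mul]

/-- The functional `f(g) P_x` is `-S(P_x)`. Both sides obey the same skew Leibniz rule in `q`; on `q
= P_y` the sign is `F(g, g) = -1` and the rest is `M_g^* = M_{g⁻¹}`. -/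
theorem ev_fT_prim (T : D.Phi × D.SK) {g : D.IF} (hg : D.n g ≠ 0) (x : Module.Dual k (D.V g))
    (q : DualCop k D.H) :
    DualCop.ev (fT T q) (D.char (D.F g) * D.prim g x) = -DualCop.ev (fT T (D.prim g x)) q := by
  induction q using D.dual_induction with
  | char α =>
    rw [fT_char, fT_prim T hg (D.mul_inv g), ev_ofG_mul, ev_char, ev_prim, ev_char, P_ofG,
      charHom_ofV, mul_zero, neg_zero]
  | prim h y hh =>
    by_cases e : (g : G) * h = 1
    · have e' : (h : G) * g = 1 := by rw [mul_comm, e]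
      rw [fT_prim T hg e, fT_prim T hh e', ev_ofV_mul, ev_char, ev_char, ev_prim, ev_prim, ev_prim,
        charHom_ofV, charHom_ofG, P_ofV, P_ofV, pairing_self, pairing_self, g.2,
        T.2.adjoint g h hg hh e e']
      simp
    · have h₁ : g ≠ D.inv h := fun e' => e (by rw [e', inv_mul])
      have h₂ : h ≠ D.inv g := fun e' => e (by rw [e', mul_inv])
      rw [fT_prim T hg (D.mul_inv g), fT_prim T hh (D.mul_inv h), ev_ofV_mul, ev_char, ev_prim,
        ev_prim, ev_prim, charHom_ofV, P_ofV, P_ofV, D.pairing_ne _ _ h₁, D.pairing_ne _ _ h₂]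
      simp
  | add p q hp hq =>
    simp only [DualCop.ev_linear_mul, map_add, neg_add] at hp hq ⊢
    rw [hp, hq]
  | smul c p hp =>
    simp only [DualCop.ev_linear_mul, map_smul] at hp ⊢
    rw [hp, smul_neg]
  | mul p q hp hq =>
    have h₁ : DualCop.ev (fT T q) 1 = DualCop.ev 1 q := by
      rw [DualCop.ev_one, ← DualCop.counit_apply]
      exact CoalgHomClass.counit_comp_apply (fT T) q
    have h₂ : D.F (D.inv g : G) = (D.F g)⁻¹ := by rw [coe_inv, map_inv]
    have h₃ : Coalgebra.comul (R := k) (D.char (D.F g) * D.prim g x) =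
        (D.char (D.F g) * D.prim g x) ⊗ₜ[k] D.char (D.F g) +
          1 ⊗ₜ[k] (D.char (D.F g) * D.prim g x) := by
      rw [Bialgebra.comul_mul, comul_char, comul_prim, mul_add,
        Algebra.TensorProduct.tmul_mul_tmul, Algebra.TensorProduct.tmul_mul_tmul, mul_one,
        char_mul_char, ← map_mul, mul_inv_cancel, map_one, char_one]
    rw [map_mul (fT T), ← DualCop.ev₂_comul, h₃, map_add, DualCop.ev₂_tmul, DualCop.ev₂_tmul, hp, hq,
      fT_prim T hg (D.mul_inv g), ev_ofV_mul, h₁, ev_fT_char, T.1.fix g hg, coe_inv]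
    ring

/-- This symmetry is the content of `R₂₁ = (S ⊗ I)(R)`. It extends from generators to products in
`p` because `S` reverses products and `f_T` respects coproducts. -/
theorem ev_fT_antipode (T : D.Phi × D.SK) (p q : DualCop k D.H) :
    DualCop.ev (fT T q) (HopfAlgebra.antipode k p) = DualCop.ev (fT T p) q := by
  induction p using D.dual_induction generalizing q with
  | char α => rw [antipode_char, ev_fT_char, fT_char, T.1.apply_inv, inv_inv]
  | prim g x hg => rw [antipode_prim, map_neg, ev_fT_prim T hg, neg_neg]
  | add p p' hp hp' =>
    have := congrArg₂ (· + ·) (hp q) (hp' q)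
    simp only [DualCop.ev_linear_mul, map_add] at this ⊢
    exact this
  | smul c p hp =>
    have := congrArg (c • ·) (hp q)
    simp only [DualCop.ev_linear_mul, map_smul] at this ⊢
    exact this
  | mul p p' hp hp' =>
    rw [HopfAlgebra.antipode_mul_antidistrib, map_mul (fT T), ← DualCop.ev₂_comul]
    refine (ev_bialgHom_mul (fT T : DualCop k D.H →ₐc[k] D.H) _ _ q).trans ?_
    generalize Coalgebra.comul (R := k) q = t
    induction t with
    | zero => simp
    | add s t hs ht => simp only [map_add, hs, ht]
    | tmul a b =>
      rw [DualCop.ev₂_tmul, ← hp, ← hp']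
      rfl

/-- The tensor `R_T` with `f_{R_T} = f_T`. -/
def RT (T : D.Phi × D.SK) : D.H ⊗[k] D.H :=
  (exists_fR_eq ((fT T : DualCop k D.H →ₐc[k] D.H) : DualCop k D.H →ₗc[k] D.H).toLinearMap).choose

@[simp] theorem fR_RT (T : D.Phi × D.SK) (p : DualCop k D.H) : fR k (RT T) p = fT T p :=
  (exists_fR_eq
    ((fT T : DualCop k D.H →ₐc[k] D.H) : DualCop k D.H →ₗc[k] D.H).toLinearMap).choose_spec p

theorem comm_RT (T : D.Phi × D.SK) :
    TensorProduct.comm k D.H D.H (RT T) = (HopfAlgebra.antipode k).rTensor D.H (RT T) := by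
  refine contract_ext fun p => ev_ext (k := k) fun q => ?_
  rw [contract_rTensor, DualCop.ev_linear_mul, apply_contract_comm, ← fR_eq_contract, fR_RT]
  -- The antipode of the dual is composition with `S⁻¹`, so it takes `p ∘ S` back to `p`.
  have h := ev_fT_antipode T (DualCop.of (p ∘ₗ HopfAlgebra.antipode k)) q
  rw [ev_antipode, DualCop.ev_of, LinearMap.comp_apply, antipode_skewAntipode] at h
  rw [h, ← fR_RT, fR_eq_contract]
  rfl

theorem comul_comm_RT (T : D.Phi × D.SK) (a : D.H) :
    TensorProduct.comm k D.H D.H (Coalgebra.comul (R := k) a) * RT T =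
      RT T * Coalgebra.comul (R := k) a := by
  induction a using D.induction with
  | hc c =>
    have e : TensorProduct.comm k D.H D.H (algebraMap k _ c) = algebraMap k _ c :=
      (Algebra.TensorProduct.comm k D.H D.H).commutes c
    rw [Bialgebra.comul_algebraMap, e, Algebra.commutes]
  | hG a =>
    refine contract_ext fun p => ?_
    have h := fT_trans_ofG T a ((DualCop.toDual k D.H).symm p)
    have h₁ := contract_tmul_mul (RT T) (D.ofG a) (D.ofG a) ((DualCop.toDual k D.H).symm p)
    have h₂ := contract_mul_tmul (RT T) (D.ofG a) (D.ofG a) ((DualCop.toDual k D.H).symm p)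
    rw [LinearEquiv.apply_symm_apply, fR_RT] at h₁ h₂
    rw [comul_ofG, TensorProduct.comm_tmul, h₁, h₂, h]
  | hV g v =>
    refine contract_ext fun p => ?_
    have h := fT_trans_ofV T g v ((DualCop.toDual k D.H).symm p)
    have h₁ := fun a b => contract_tmul_mul (RT T) a b ((DualCop.toDual k D.H).symm p)
    have h₂ := fun a b => contract_mul_tmul (RT T) a b ((DualCop.toDual k D.H).symm p)
    simp only [LinearEquiv.apply_symm_apply, fR_RT] at h₁ h₂
    have e : transL (1 : D.H) ((DualCop.toDual k D.H).symm p) = (DualCop.toDual k D.H).symm p :=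
      DualCop.ext_ev fun z => by rw [ev_transL, one_mul]
    rw [comul_ofV, map_add, TensorProduct.comm_tmul, TensorProduct.comm_tmul, add_mul, mul_add,
      map_add, map_add, h₁, h₁, h₂, h₂, e, h, mul_one]
  | hadd y z hy hz => simp only [map_add, add_mul, mul_add, hy, hz]
  | hmul y z hy hz =>
    have e : TensorProduct.comm k D.H D.H (Coalgebra.comul (R := k) y * Coalgebra.comul (R := k) z) =
        TensorProduct.comm k D.H D.H (Coalgebra.comul (R := k) y) *
          TensorProduct.comm k D.H D.H (Coalgebra.comul (R := k) z) :=
      map_mul (Algebra.TensorProduct.comm k D.H D.H) _ _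
    rw [Bialgebra.comul_mul, e, mul_assoc, hz, ← mul_assoc, hy, mul_assoc]

theorem isMinimalTriangular_RT (T : D.Phi × D.SK) : IsMinimalTriangular k (RT T) := by
  have h₁ : TensorProduct.assoc k D.H D.H D.H
      ((Coalgebra.comul (R := k) (A := D.H)).rTensor D.H (RT T)) =
        TensorProduct.leftComm k D.H D.H D.H (1 ⊗ₜ[k] RT T) * (1 ⊗ₜ[k] RT T) :=
    (comul_left_iff _).2 fun p q => by simp only [fR_RT, map_mul]
  have h₂ : RT T * TensorProduct.comm k D.H D.H (RT T) = 1 := by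
    rw [comm_RT]
    exact mul_antipode_rTensor_eq_one h₁ (by rw [fR_RT, map_one])
  refine
    { comul_left := h₁
      comul_right := (comul_right_iff _).2 fun p => ?_
      comul_comm := comul_comm_RT T
      mul_swap := h₂
      swap_mul := swap_mul_of_mul_swap h₂
      minimal := fun B _ hB => minimal_of_fR_surjective (fun a => ?_) B hB }
  · have e : fRLin (RT T) = ((fT T : DualCop k D.H →ₐc[k] D.H) :
        DualCop k D.H →ₗc[k] D.H).toLinearMap := LinearMap.ext (fR_RT T)
    rw [e, fR_RT]
    exact (CoalgHomClass.map_comp_comul_apply (fT T) p).symm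
  · obtain ⟨p, hp⟩ := (fT T).surjective a
    exact ⟨p, (fR_RT T p).trans hp⟩

theorem RT_injective : Function.Injective (RT : D.Phi × D.SK → D.H ⊗[k] D.H) := by
  intro T T' h
  have e : ∀ p, fT T p = fT T' p := fun p => by rw [← fR_RT, h, fR_RT]
  refine Prod.ext (Phi.ext (MulEquiv.ext fun α => ?_)) (SK.ext ?_)
  · apply D.ofG_injective
    rw [← fT_char, e, fT_char]
  · funext g h hg e'
    refine LinearEquiv.ext fun x => D.ofV_injective h ?_
    rw [← fT_prim, e, fT_prim]

end

section

variable {k : Type u} [Field k] {G : Type w} [CommGroup G] (D : Datum k G)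

/-! ### Grouplike and skew primitive elements -/

/-- Pull `χ` back along `f` and use that `f` is onto; skew symmetry of `F` turns the first argument
into the second, up to an inverse. -/
theorem exists_eq_eval (D : Datum k G) (χ : (G →* kˣ) →* kˣ) : ∃ a : G, ∀ α, χ α = α a := by
  obtain ⟨b, hb⟩ := D.nondegenerate.surjective (χ.comp D.F)
  refine ⟨b⁻¹, fun α => ?_⟩
  obtain ⟨g, rfl⟩ := D.nondegenerate.surjective α
  have : χ (D.F g) = D.F b g := (DFunLike.congr_fun hb g).symm
  rw [this, map_inv, D.skew]

theorem ev_mul_of_comul {z c d e b : D.H}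
    (hz : Coalgebra.comul (R := k) z = b ⊗ₜ[k] c + d ⊗ₜ[k] e) (p q : DualCop k D.H) :
    DualCop.ev z (p * q) = DualCop.ev b p * DualCop.ev c q + DualCop.ev d p * DualCop.ev e q := by
  rw [ev_mul_eq, hz]
  simp [DualCop.ev_linear_mul]

theorem char_injective : Function.Injective D.char := by
  intro α β h
  ext a
  have := congrArg (DualCop.ev (D.ofG a)) h
  rwa [ev_char, ev_char, charHom_ofG, charHom_ofG] at this

theorem exists_dual_ne_zero {D : Datum k G} {g : D.IF} (hg : D.n g ≠ 0) :
    ∃ x : Module.Dual k (D.V g), x ≠ 0 := by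
  have : Nonempty (Fin (D.n g)) := ⟨⟨0, Nat.pos_of_ne_zero hg⟩⟩
  exact exists_ne 0

variable [CharZero k] [Finite G]

theorem prim_mul_self (g : D.IF) (x : Module.Dual k (D.V g)) : D.prim g x * D.prim g x = 0 := by
  have h := D.prim_mul_prim g g x x
  rw [g.2, Units.val_neg, Units.val_one, neg_one_smul] at h
  have h2 : (2 : k) • (D.prim g x * D.prim g x) = 0 := by
    rw [two_smul]; nth_rewrite 1 [h]; exact neg_add_cancel _
  exact (smul_eq_zero.mp h2).resolve_left two_ne_zero

/-- The grouplike elements of `H(D)` are the elements of `G`. -/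
theorem exists_eq_ofG {z : D.H} (hz : Coalgebra.comul (R := k) z = z ⊗ₜ[k] z)
    (h1 : Coalgebra.counit (R := k) z = 1) : ∃ a, z = D.ofG a := by
  have hmul : ∀ p q : DualCop k D.H, DualCop.ev z (p * q) = DualCop.ev z p * DualCop.ev z q := fun p q => by
    rw [ev_mul_eq, hz]; rfl
  let χ : (G →* kˣ) →* k :=
    { toFun := fun α => DualCop.ev z (D.char α)
      map_one' := by rw [char_one, DualCop.ev_one, h1]
      map_mul' := fun α β => by rw [← char_mul_char, hmul] }
  obtain ⟨a, ha⟩ := D.exists_eq_eval χ.toHomUnits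
  refine ⟨a, ev_ext (k := k) fun p => ?_⟩
  induction p using D.dual_induction with
  | char α =>
    have := congrArg Units.val (ha α)
    rw [MonoidHom.coe_toHomUnits] at this
    rw [ev_char D α (D.ofG a), charHom_ofG, ← this]
    rfl
  | prim g x hg =>
    -- A grouplike is an algebra map on the dual, and `P_x` squares to zero.
    have h := hmul (D.prim g x) (D.prim g x)
    rw [prim_mul_self, map_zero, zero_eq_mul_self] at h
    rw [h, ev_prim, P_ofG]
  | add p q hp hq => rw [map_add, map_add, hp, hq]
  | smul c p hp => rw [map_smul, map_smul, hp]
  | mul p q hp hq => rw [hmul, ev_ofG_mul, hp, hq]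

/-- The grouplike elements of `H(D)^{*cop}` are the characters. -/
theorem exists_eq_char {p : DualCop k D.H} (hp : Coalgebra.comul (R := k) p = p ⊗ₜ[k] p)
    (h1 : Coalgebra.counit (R := k) p = 1) : ∃ α, p = D.char α := by
  have hmul : ∀ y z, DualCop.ev (y * z) p = DualCop.ev y p * DualCop.ev z p := fun y z => by
    rw [← DualCop.ev₂_comul, hp, DualCop.ev₂_tmul, mul_comm]
  let α : G →* k :=
    { toFun := fun a => DualCop.ev (D.ofG a) p
      map_one' := by rw [map_one, ← DualCop.counit_apply, h1]
      map_mul' := fun a b => by rw [map_mul, hmul] }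
  refine ⟨α.toHomUnits, DualCop.ext_ev fun z => ?_⟩
  rw [ev_char]
  induction z using D.induction with
  | hc c =>
    rw [AlgHom.commutes, Algebra.algebraMap_eq_smul_one, DualCop.ev_linear_mul, map_smul,
      ← DualCop.ev_linear_mul, ← DualCop.counit_apply, h1]
    simp
  | hG a =>
    rw [charHom_ofG, MonoidHom.coe_toHomUnits]
    rfl
  | hV g v =>
    have h := hmul (D.ofV g v) (D.ofV g v)
    rw [ofV_mul_self, DualCop.ev_linear_mul, map_zero, zero_eq_mul_self] at h
    rw [h, charHom_ofV]
  | hadd y z hy hz => rw [map_add, ← hy, ← hz]; simp only [DualCop.ev_linear_mul, map_add]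
  | hmul y z hy hz => rw [map_mul, hmul, hy, hz]

/-- Two skew primitive elements are equal if all generators of the dual agree on them. -/
theorem eq_of_comul_eq' {y z c d : D.H}
    (hy : Coalgebra.comul (R := k) y = y ⊗ₜ[k] c + d ⊗ₜ[k] y)
    (hz : Coalgebra.comul (R := k) z = z ⊗ₜ[k] c + d ⊗ₜ[k] z)
    (hchar : ∀ α, D.charHom α y = D.charHom α z) (hP : ∀ g x, D.P g x y = D.P g x z) : y = z := by
  refine ev_ext (k := k) fun p => ?_
  induction p using D.dual_induction with
  | char α => exact hchar α
  | prim g x _ => exact hP g x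
  | add p q hp hq => rw [map_add, map_add, hp, hq]
  | smul c p hp => rw [map_smul, map_smul, hp]
  | mul p q hp hq => rw [D.ev_mul_of_comul hy, D.ev_mul_of_comul hz, hp, hq]

/-- Some `P_z` with `z ∈ V_h^*` is nonzero on `y`, since generators of the dual detect skew
primitives. Evaluating the relation between `P_z` and a character `α` on `y` gives `α(c) = α(h)`, so
`c = h` is the only index that contributes. -/
theorem exists_eq_ofV {y : D.H} {c : G}
    (hy : Coalgebra.comul (R := k) y = y ⊗ₜ[k] 1 + D.ofG c ⊗ₜ[k] y)
    (hchar : ∀ α, D.charHom α y = 0) (h0 : y ≠ 0) :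
    ∃ (h : D.IF) (v : D.V h), (h : G) = c ∧ y = D.ofV h v := by
  have hP : ∀ (h : D.IF) z, D.P h z y ≠ 0 → c = h := by
    intro h z hz
    rw [← div_eq_one]
    refine D.eq_one_of_forall_char fun α => ?_
    have e := congrArg (DualCop.ev y) (D.prim_mul_char h z α)
    rw [Units.smul_def, map_smul, D.ev_mul_of_comul hy, D.ev_mul_of_comul hy] at e
    simp only [ev_prim, ev_char, P_one, P_ofG, hchar, charHom_ofG, map_one, mul_one, mul_zero,
      add_zero, zero_add, smul_eq_mul, ← mul_assoc] at e
    have e' : (1 : k) = (((α h)⁻¹ : kˣ) : k) * (α c : k) :=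
      mul_right_cancel₀ hz (by rw [one_mul]; exact e)
    rw [map_div, div_eq_mul_inv, mul_comm]
    exact Units.ext (by rw [Units.val_mul, ← e', Units.val_one])
  obtain ⟨h, z, hz⟩ : ∃ (h : D.IF) (z : _), D.P h z y ≠ 0 := by
    by_contra! hcon
    exact h0 (D.eq_of_comul_eq' hy (z := 0) (by simp) (by simpa using hchar) (by simpa using hcon))
  obtain rfl := hP h z hz
  -- The vector is the one that represents `x ↦ P_x(y)` on `V_h^*`, by reflexivity.
  refine ⟨h, (Module.evalEquiv k (D.V h)).symm (DualCop.ev y ∘ₗ D.primLin h), rfl,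
    D.eq_of_comul_eq' hy (D.comul_ofV h _) (fun α => by rw [hchar, charHom_ofV]) fun g x => ?_⟩
  by_cases e : g = h
  · subst e
    rw [P_ofV, pairing_self, Module.apply_evalEquiv_symm_apply]
    rfl
  · rw [P_ofV, D.pairing_ne g h e]
    by_contra hne
    exact e (Subtype.ext (hP g x hne).symm)

variable {D}

/-! ### The pair of a minimal triangular structure -/

section converse

variable {R : D.H ⊗[k] D.H} (hR : IsMinimalTriangular k R)

theorem fR_bijective (hR : IsMinimalTriangular k R) : Function.Bijective (fR k R) := by
  have hs : Function.Surjective (fR k R) := hR.fR_surjective fun p =>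
    ⟨HopfAlgebra.antipode k p, (map_antipode hR.toIsTriangular.bialgHom p).symm⟩
  exact ⟨(LinearMap.injective_iff_surjective_of_finrank_eq_finrank D.finrank_dualCop
    (f := fRLin R)).2 hs, hs⟩

/-- `f_R` as an isomorphism of bialgebras. -/
def fREquiv (hR : IsMinimalTriangular k R) : DualCop k D.H ≃ₐc[k] D.H :=
  BialgEquiv.ofBijective hR.toIsTriangular.bialgHom (fR_bijective hR)

theorem fREquiv_apply (p : DualCop k D.H) : fREquiv hR p = fR k R p := rfl

/-- Pair `R₂₁ = (S ⊗ I)(R)` with functionals. Taken on characters and on the `P_x`, it yields both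
adjointness conditions. -/
theorem ev_fREquiv_antipode (p q : DualCop k D.H) :
    DualCop.ev (fREquiv hR q) (HopfAlgebra.antipode k p) = DualCop.ev (fREquiv hR p) q := by
  have h := congrArg (fun t => DualCop.toDual k D.H q
    (contract (DualCop.toDual k D.H (HopfAlgebra.antipode k p)) t))
    (hR.toIsTriangular.comm_eq hR.toIsTriangular.fR_one)
  simp only [apply_contract_comm, contract_rTensor] at h
  have e : DualCop.toDual k D.H (HopfAlgebra.antipode k p) ∘ₗ HopfAlgebra.antipode k =
      DualCop.toDual k D.H p :=
    LinearMap.ext fun z => congrArg (DualCop.toDual k D.H p) (D.skewAntipode_antipode z)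
  rw [e] at h
  exact h

theorem fREquiv_trans_ofG (a : G) (p : DualCop k D.H) :
    D.ofG a * fREquiv hR (transL (D.ofG a) p) = fREquiv hR (transR (D.ofG a) p) * D.ofG a := by
  have h := congrArg (contract (DualCop.toDual k D.H p)) (hR.comul_comm (D.ofG a))
  rw [comul_ofG, TensorProduct.comm_tmul, contract_tmul_mul, contract_mul_tmul] at h
  exact h

theorem comul_fREquiv (p : DualCop k D.H) : Coalgebra.comul (R := k) (fREquiv hR p) =
    TensorProduct.map (fRLin R) (fRLin R) (Coalgebra.comul (R := k) p) :=
  (comul_right_iff R).1 hR.comul_right p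

theorem exists_fREquiv_char (α : G →* kˣ) : ∃ a, fREquiv hR (D.char α) = D.ofG a := by
  refine D.exists_eq_ofG ?_ ?_
  · rw [comul_fREquiv, comul_char, TensorProduct.map_tmul]
    rfl
  · exact (hR.toIsTriangular.counit_fR _).trans (D.counit_char α)

/-- The map `G^* → G` given by `f_R` on the grouplike elements. -/
def charMap : (G →* kˣ) →* G where
  toFun α := (exists_fREquiv_char hR α).choose
  map_one' := by
    apply D.ofG_injective
    rw [← (exists_fREquiv_char hR 1).choose_spec, char_one, map_one, map_one]
  map_mul' α β := by
    apply D.ofG_injective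
    rw [map_mul, ← (exists_fREquiv_char hR _).choose_spec, ← (exists_fREquiv_char hR _).choose_spec,
      ← (exists_fREquiv_char hR _).choose_spec, ← char_mul_char, map_mul]

theorem fREquiv_char (α : G →* kˣ) : fREquiv hR (D.char α) = D.ofG (charMap hR α) :=
  (exists_fREquiv_char hR α).choose_spec

theorem charMap_bijective : Function.Bijective (charMap hR) := by
  constructor
  · intro α β h
    apply D.char_injective
    apply (fREquiv hR).injective
    exact (fREquiv_char hR α).trans ((congrArg D.ofG h).trans (fREquiv_char hR β).symm)
  · intro a
    obtain ⟨α, hα⟩ := D.exists_eq_char (p := (fREquiv hR).symm (D.ofG a))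
      (by
        rw [← CoalgHomClass.map_comp_comul_apply (fREquiv hR).symm, comul_ofG,
          TensorProduct.map_tmul]
        rfl)
      ((CoalgHomClass.counit_comp_apply (fREquiv hR).symm _).trans (D.counit_ofG a))
    refine ⟨α, D.ofG_injective ?_⟩
    rw [← fREquiv_char, ← hα, BialgEquiv.apply_symm_apply]

theorem charMap_adjoint (α β : G →* kˣ) : α (charMap hR β) = β (charMap hR α⁻¹) := by
  have h := ev_fREquiv_antipode hR (D.char α⁻¹) (D.char β)
  rw [antipode_char, char_inv_inv, fREquiv_char, fREquiv_char, ev_char, ev_char, charHom_ofG,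
    charHom_ofG] at h
  exact Units.ext h

theorem ofG_mul_fREquiv_prim (a : G) (g : D.IF) (x : Module.Dual k (D.V g)) :
    D.ofG a * fREquiv hR (D.prim g x) =
      (D.F a g : k) • (fREquiv hR (D.prim g x) * D.ofG a) := by
  have h := fREquiv_trans_ofG hR a (D.prim g x)
  rwa [transL_ofG_prim, transR_ofG_prim, map_smul, smul_mul_assoc] at h

/-- The image is skew primitive, so it lies in some `V_h` once characters are known to kill it.
Comparing its commutation with `a ∈ G` given by `R` with the one in `V_h` gives `F(a, g) F(a, h) =
1` for all `a`, hence `g h = 1`. -/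
theorem exists_fREquiv_prim {g : D.IF} {x : Module.Dual k (D.V g)} (hx : x ≠ 0) :
    ∃ (h : D.IF) (v : D.V h), (g : G) * h = 1 ∧ (h : G) = charMap hR (D.F (g : G)⁻¹) ∧
      fREquiv hR (D.prim g x) = D.ofV h v := by
  have h0 : fREquiv hR (D.prim g x) ≠ 0 := by
    intro h0
    apply hx
    apply D.prim_injective g
    rw [← primLin_apply _ _ 0, map_zero]
    exact (fREquiv hR).injective (h0.trans (map_zero (fREquiv hR)).symm)
  obtain ⟨h, v, hc, hv⟩ := D.exists_eq_ofV (y := fREquiv hR (D.prim g x))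
    (c := charMap hR (D.F (g : G)⁻¹))
    (by
      rw [comul_fREquiv, comul_prim, map_add, TensorProduct.map_tmul, TensorProduct.map_tmul,
        ← fREquiv_char]
      simp only [fRLin_apply, hR.toIsTriangular.fR_one]
      rfl)
    (fun α => by
      -- With `a = g` the scalar is `F(g, g) = -1`, so the value of any character equals its own
      -- negative.
      have e := congrArg (D.charHom α) (ofG_mul_fREquiv_prim hR g g x)
      rw [map_mul, map_smul, map_mul, charHom_ofG, g.2, Units.val_neg, Units.val_one,
        smul_eq_mul] at e
      have e' : (2 * (α g : k)) * D.charHom α (fREquiv hR (D.prim g x)) = 0 := by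
        linear_combination e
      exact (mul_eq_zero.1 e').resolve_left (mul_ne_zero two_ne_zero (α g).ne_zero))
    h0
  refine ⟨h, v, ?_, hc, hv⟩
  apply D.nondegenerate.injective
  refine MonoidHom.ext fun a => ?_
  have e := ofG_mul_fREquiv_prim hR a g x
  rw [hv, ofV_mul_ofG, smul_smul] at e
  have e' := congrArg (D.ofG a⁻¹ * ·) e
  simp only [mul_smul_comm, ofG_mul_ofG_mul, inv_mul_cancel, map_one, one_mul] at e'
  have e'' : (1 - (D.F a g : k) * (D.F a h : k)) • D.ofV h v = 0 := by
    rw [sub_smul, one_smul, ← e', sub_self]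
  have e₃ := (smul_eq_zero.1 e'').resolve_right (hv ▸ h0)
  rw [map_one, MonoidHom.one_apply, D.skew, inv_eq_one, map_mul]
  exact Units.ext (by rw [Units.val_mul, Units.val_one]; exact (sub_eq_zero.1 e₃).symm)

/-- A nonzero `x ∈ V_g^*` exists, and the degree of its image is both `g⁻¹` and `φ(f(g⁻¹))`. -/
theorem charMap_F {g : D.IF} (hg : D.n g ≠ 0) : charMap hR (D.F g) = g := by
  obtain ⟨x, hx⟩ := exists_dual_ne_zero hg
  obtain ⟨h, v, e, hc, _⟩ := exists_fREquiv_prim hR hx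
  have : charMap hR (D.F (g : G)⁻¹) = (charMap hR (D.F g))⁻¹ := by
    rw [map_inv]
    exact map_inv (charMap hR) (D.F g)
  rw [this, eq_inv_iff_mul_eq_one] at hc
  have e' := mul_eq_one_iff_eq_inv.1 e
  exact (eq_inv_of_mul_eq_one_right hc).trans e'.symm

theorem fREquiv_prim_mem {g h : D.IF} (e : (g : G) * h = 1) (x : Module.Dual k (D.V g)) :
    fREquiv hR (D.prim g x) ∈ LinearMap.range (D.ofV h) := by
  by_cases hx : x = 0
  · rw [hx, ← primLin_apply, map_zero, map_zero]
    exact zero_mem _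
  · obtain ⟨h', v, e', _, hv⟩ := exists_fREquiv_prim hR hx
    obtain rfl : h' = h := Subtype.ext (mul_left_cancel (e'.trans e.symm))
    exact ⟨v, hv.symm⟩

/-- The map `V_g^* → V_{g⁻¹}` given by `f_R` on the functionals `P_x`. -/
def primMap {g h : D.IF} (e : (g : G) * h = 1) : Module.Dual k (D.V g) →ₗ[k] D.V h :=
  (LinearEquiv.ofInjective (D.ofV h) (D.ofV_injective h)).symm.toLinearMap ∘ₗ
    LinearMap.codRestrict _ (fRLin R ∘ₗ D.primLin g) (fREquiv_prim_mem hR e)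

theorem ofV_primMap {g h : D.IF} (e : (g : G) * h = 1) (x : Module.Dual k (D.V g)) :
    D.ofV h (primMap hR e x) = fREquiv hR (D.prim g x) :=
  congrArg Subtype.val ((LinearEquiv.ofInjective (D.ofV h) (D.ofV_injective h)).apply_symm_apply
    ⟨_, fREquiv_prim_mem hR e x⟩)

theorem primMap_injective {g h : D.IF} (e : (g : G) * h = 1) :
    Function.Injective (primMap hR e) := by
  intro x y hxy
  have := congrArg (D.ofV h) hxy
  rw [ofV_primMap, ofV_primMap] at this
  exact D.prim_injective g ((fREquiv hR).injective this)

theorem n_le_of_isMinimalTriangular {g h : D.IF} (hR : IsMinimalTriangular k R)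
    (e : (g : G) * h = 1) : D.n g ≤ D.n h := by
  have := LinearMap.finrank_le_finrank_of_injective (primMap_injective hR e)
  rwa [Subspace.dual_finrank_eq, Module.finrank_fin_fun, Module.finrank_fin_fun] at this

theorem primMap_bijective {g h : D.IF} (e : (g : G) * h = 1) :
    Function.Bijective (primMap hR e) := by
  -- Injectivity for `g` and for `g⁻¹` bounds the dimensions in both directions.
  have hn : D.n g = D.n h := le_antisymm (n_le_of_isMinimalTriangular hR e)
    (n_le_of_isMinimalTriangular hR (by rw [mul_comm, e]))
  refine ⟨primMap_injective hR e, (LinearMap.injective_iff_surjective_of_finrank_eq_finrank ?_).1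
    (primMap_injective hR e)⟩
  rw [Subspace.dual_finrank_eq, Module.finrank_fin_fun, Module.finrank_fin_fun, hn]

theorem primMap_adjoint {g h : D.IF} (e : (g : G) * h = 1) (e' : (h : G) * g = 1)
    (x : Module.Dual k (D.V g)) (y : Module.Dual k (D.V h)) :
    y (primMap hR e x) = x (primMap hR e' y) := by
  have H := ev_fREquiv_antipode hR (D.prim g x) (D.prim h y)
  rw [antipode_prim, map_neg, ← ofV_primMap hR e, ← ofV_primMap hR e', ev_ofV_mul, ev_char, ev_char,
    ev_prim, ev_prim, ev_prim, charHom_ofV, charHom_ofG, P_ofV, P_ofV, pairing_self, pairing_self,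
    g.2] at H
  rw [← H]
  simp

/-- The pair `(φ, M)` of a minimal triangular structure. -/
def pairOf (hR : IsMinimalTriangular k R) : D.Phi × D.SK where
  fst :=
    { φ := MulEquiv.ofBijective (charMap hR) (charMap_bijective hR)
      adjoint := charMap_adjoint hR
      fix := fun _ hg => charMap_F hR hg }
  snd :=
    { M := fun _ _ _ e => LinearEquiv.ofBijective (primMap hR e) (primMap_bijective hR e)
      adjoint := fun _ _ _ _ e e' => primMap_adjoint hR e e' }

theorem sends_fREquiv : D.Sends (pairOf hR) (fREquiv hR) :=
  ⟨fREquiv_char hR, fun _ _ _ e x => (ofV_primMap hR e x).symm⟩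

theorem RT_pairOf : RT (pairOf hR) = R :=
  fR_ext fun p => by rw [fR_RT, ← (sends_fREquiv hR).eq_fT, fREquiv_apply]

end converse

theorem RT_bijective : Function.Bijective fun T : D.Phi × D.SK =>
    (⟨RT T, isMinimalTriangular_RT T⟩ : {R : D.H ⊗[k] D.H // IsMinimalTriangular k R}) := by
  constructor
  · intro T T' h
    have h' : RT T = RT T' := by
      simpa only [Subtype.mk.injEq] using h
    exact RT_injective h'
  · rintro ⟨R, hR⟩
    exact ⟨pairOf hR, Subtype.ext (RT_pairOf hR)⟩

variable (D) in
/-- Pairs `(φ, M)` correspond to minimal triangular structures on `H(D)`. -/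
def equivTriangular : D.Phi × D.SK ≃ {R : D.H ⊗[k] D.H // IsMinimalTriangular k R} :=
  Equiv.ofBijective _ RT_bijective

end

end Datum

end TriHopf

end

theorem theorem4p4 {k : Type*} [Field k] [IsAlgClosed k] [CharZero k]
    {G : Type*} [CommGroup G] [Finite G] (D : TriHopf.Datum k G) :
    (∀ T : D.Phi × D.SK, ∃! f : TriHopf.DualCop k D.H ≃ₐc[k] D.H, D.Sends T f) ∧
    ∃ E : D.Phi × D.SK ≃ {R : TensorProduct k D.H D.H // TriHopf.IsMinimalTriangular k R},
      ∀ (T : D.Phi × D.SK) (f : TriHopf.DualCop k D.H ≃ₐc[k] D.H), D.Sends T f →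
        ∀ p : TriHopf.DualCop k D.H, TriHopf.fR k (E T).1 p = f p := by
  refine ⟨fun T => ⟨TriHopf.Datum.fT T, TriHopf.Datum.sends_fT T, fun f hf => hf.eq_fT⟩,
    D.equivTriangular, fun T f hf p => ?_⟩
  rw [hf.eq_fT]
  exact TriHopf.Datum.fR_RT T p
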